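/- All graphs have a finite nonempty vertex set. A cograph is a simple undirected graph obtained from single-vertex graphs by repeatedly taking disjoint unions and joints (complete joins). A graph $G$ is distance-hereditary if $d_H(x,y)=d_G(x,y)$ for every connected induced subgraph $H$ of $G$ and all vertices $x,y$ of $H$. A network is a connected finite directed acyclic graph $N$ in which every vertex of indegree $0$ (a root) has outdegree at least $2$, every vertex of outdegree $0$ (a leaf) has indegree $1$, and no vertex has both indegree $1$ and outdegree $1$. It is arboreal if its underlying undirected graph is a tree. It is a galled-tree if it has exactly one root, all its vertices have indegree at most $2$, and every biconnected component of its underlying undirected graph contains at most one vertex of indegree $2$; here a biconnected component is the subgraph induced by an inclusion-maximal set $Y$ of at least three vertices such that, for each $x\in Y$, the subgraph induced by $Y\setminus\{x\}$ is connected. A labelled network is a pair $(N,t)$ where $N$ is a network and $t$ maps the vertices of $N$ of outdegree at least $2$ to $\{0,1\}$. A vertex $u$ is an ancestor of $v$ if there is a directed path, possibly of length $0$, from $u$ to $v$; a least common ancestor of two leaves $x,y$ is a common ancestor $u$ of $x$ and $y$ such that no child of $u$ is a common ancestor of $x$ and $y$. In an arboreal network or a galled-tree, two distinct leaves $x,y$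 that have a common ancestor have a unique least common ancestor $\operatorname{lca}_N(x,y)$. A labelled arboreal network or labelled galled-tree $(N,t)$ explains a graph $G$ if the leaf set of $N$ is $V(G)$ and, for all distinct $x,y\in V(G)$, $\{x,y\}$ is an edge of $G$ if and only if $x$ and $y$ have a common ancestor in $N$ and $t(\operatorname{lca}_N(x,y))=1$. A graph is a GaTEx graph if it is explained by some labelled galled-tree. **Proposition.** Let $G$ be a graph that is not a cograph. There exists a labelled arboreal network with exactly two roots that explains $G$ if and only if $G$ is distance-hereditary, $G$ is a GaTEx graph, and exactly one connected component of $G$ is not a cograph. -/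

import Mathlib

universe u

namespace ArborealNetworks

section UndirectedGraphs

variable {V : Type u}

/-- `CographOn G A` says that the induced subgraph `G[A]` is a cograph: a single vertex is a
cograph, and so are the disjoint union and the joint of two vertex-disjoint cographs. -/
inductive CographOn (G : SimpleGraph V) : Set V → Prop
  | single (v : V) : CographOn G {v}
  | disjointUnion (A B : Set V) (hA : CographOn G A) (hB : CographOn G B) (hAB : Disjoint A B)
      (h : ∀ a ∈ A, ∀ b ∈ B, ¬ G.Adj a b) : CographOn G (A ∪ B)
  | joint (A B : Set V) (hA : CographOn G A) (hB : CographOn G B) (hAB : Disjoint A B)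
      (h : ∀ a ∈ A, ∀ b ∈ B, G.Adj a b) : CographOn G (A ∪ B)

/-- The graph `G` is a cograph. -/
def IsCograph (G : SimpleGraph V) : Prop := CographOn G Set.univ

/-- Distances in connected induced subgraphs agree with distances in `G`. -/
def IsDistanceHereditary (G : SimpleGraph V) : Prop :=
  ∀ S : Set V, (G.induce S).Connected → ∀ x y : S, G.dist (x : V) (y : V) = (G.induce S).dist x y

/-- The induced subgraph `G[Y]` is biconnected: `|Y| ≥ 3` and the removal of any one vertex of
`Y` leaves a connected graph. -/
def BiconnectedOn (G : SimpleGraph V) (Y : Set V) : Prop :=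
  3 ≤ Y.ncard ∧ ∀ x ∈ Y, (G.induce (Y \ {x})).Connected

/-- `G[Y]` is biconnected and no proper superset of `Y` has this property. -/
def IsBiconnectedComponent (G : SimpleGraph V) (Y : Set V) : Prop :=
  Maximal (BiconnectedOn G) Y

end UndirectedGraphs

section Networks

variable {W : Type u}

/-- The number of parents of `v`. -/
noncomputable def indeg (N : Digraph W) (v : W) : ℕ := {p | N.Adj p v}.ncard

/-- The number of children of `v`. -/
noncomputable def outdeg (N : Digraph W) (v : W) : ℕ := {c | N.Adj v c}.ncard

/-- Networks: connected directed acyclic graphs in which every vertex of indegree `0` has outdegree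
at least `2`, every vertex of outdegree `0` has indegree `1`, and no vertex has both indegree `1`
and outdegree `1`. -/
structure IsNetwork (N : Digraph W) : Prop where
  connected : N.toSimpleGraphInclusive.Connected
  acyclic : ∀ v, ¬ Relation.TransGen N.Adj v v
  two_le_outdeg : ∀ v, indeg N v = 0 → 2 ≤ outdeg N v
  indeg_eq_one : ∀ v, outdeg N v = 0 → indeg N v = 1
  not_subdivision : ∀ v, ¬ (indeg N v = 1 ∧ outdeg N v = 1)

/-- The set of roots of `N`. -/
def roots (N : Digraph W) : Set W := {v | indeg N v = 0}

/-- The set of leaves of `N`. -/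
def leaves (N : Digraph W) : Set W := {v | outdeg N v = 0}

/-- The set of vertices of `N` of outdegree at least `2`; these are the vertices that carry a
label. -/
def branchVertices (N : Digraph W) : Set W := {v | 2 ≤ outdeg N v}

/-- Arboreal networks: the underlying undirected graph is a tree. -/
def IsArborealNetwork (N : Digraph W) : Prop :=
  IsNetwork N ∧ N.toSimpleGraphInclusive.IsTree

/-- Phylogenetic networks: networks with exactly one root. -/
def IsPhylogeneticNetwork (N : Digraph W) : Prop :=
  IsNetwork N ∧ ∃! r, r ∈ roots N

/-- Galled-trees: phylogenetic networks in which all vertices have indegree at most `2`, and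
every biconnected component contains at most one vertex of indegree `2`. -/
def IsGalledTree (N : Digraph W) : Prop :=
  IsPhylogeneticNetwork N ∧ (∀ v, indeg N v ≤ 2) ∧
    ∀ C, IsBiconnectedComponent N.toSimpleGraphInclusive C →
      {v | v ∈ C ∧ indeg N v = 2}.ncard ≤ 1

/-- `u` is an ancestor of `v` (every vertex is an ancestor of itself). -/
def IsAncestor (N : Digraph W) (u v : W) : Prop := Relation.ReflTransGen N.Adj u v

/-- `u` is a least common ancestor of `x` and `y`: it is an ancestor of both, and no child of `u`
is an ancestor of both. -/
def IsLCA (N : Digraph W) (u x y : W) : Prop :=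
  IsAncestor N u x ∧ IsAncestor N u y ∧
    ∀ c, N.Adj u c → ¬ (IsAncestor N c x ∧ IsAncestor N c y)

/-- The labelled network `(N, t)`, with leaf set identified with `V` through `ℓ`, explains `G`:
two distinct vertices are joined by an edge if and only if they share an ancestor in `N` and their
least common ancestor has label `1`. In arboreal networks and in galled-trees two distinct leaves
have at most one least common ancestor, and it is always a vertex of outdegree at least `2`. -/
def Explains {V : Type u} (N : Digraph W) (t : branchVertices N → Fin 2) (ℓ : V ≃ leaves N)
    (G : SimpleGraph V) : Prop :=
  ∀ x y : V, x ≠ y →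
    (G.Adj x y ↔ ∃ u : branchVertices N, IsLCA N (u : W) (ℓ x) (ℓ y) ∧ t u = 1)

/-- `G` is explained by some (finite) labelled arboreal network with exactly `k` roots. -/
def ExplainedByArborealNetwork {V : Type u} (k : ℕ) (G : SimpleGraph V) : Prop :=
  ∃ (W : Type u) (_ : Finite W) (N : Digraph W) (t : branchVertices N → Fin 2)
    (ℓ : V ≃ leaves N), IsArborealNetwork N ∧ (roots N).ncard = k ∧ Explains N t ℓ G

/-- GaTEx graphs: graphs explained by some (finite) labelled galled-tree. -/
def IsGaTEx {V : Type u} (G : SimpleGraph V) : Prop :=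
  ∃ (W : Type u) (_ : Finite W) (N : Digraph W) (t : branchVertices N → Fin 2)
    (ℓ : V ≃ leaves N), IsGalledTree N ∧ Explains N t ℓ G

end Networks

end ArborealNetworks

/-!
Both sides of the equivalence amount to a decomposition `IsModuleSplit` of `G`: the vertex set is a
disjoint union of `A`, `B` and a module `H`, no edge joins `A` to `B`, and `A ∪ H` and `B ∪ H`
induce cographs. Cographs enter through Seinsche's theorem, that they are the finite graphs without
an induced path on four vertices (`P4FreeOn.cographOn`, `CographOn.p4FreeOn`).

*Galled-trees.* If `(p, q)` is an edge of a galled-tree, then at most one further edge enters the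
set of descendants of `q`: the head of such an edge has indegree two and lies in the block of `pq`
(`IsGalledTree.isGalledShape`). This implies that least common ancestors are unique, that a child
of `v` shares descendants with at most one other child of `v`, and that all paths to their common
descendants pass through one vertex. In a lowest vertex `v` whose leaves do not induce a cograph,
an induced `P4` therefore lies below two children of `v` with common descendants. Their leaves form
`A ∪ H` and `B ∪ H`, where `H` collects the common ones; `H` and `A ∪ B ∪ H` are modules, and the
label of `v` tells whether `A` is completely joined to `B` or has no edge to it
(`exists_gallSplit`).

*From a network to the decomposition.* An arboreal network with two roots becomes a galled-tree when
a root labelled `0` is added above the two roots, because a tree with two roots has only one vertex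
of indegree two (`addRoot_isGalledTree`). In the resulting galled-tree the vertex `v` above has to
be the new root, so `A ∪ B ∪ H` is everything and no edge joins `A` to `B`. The decomposition forces
`G` to be distance-hereditary, since distances within `A ∪ H` and `B ∪ H` are at most two and do not
depend on the vertex of `H`, and it places every induced `P4` in the component containing `H`.

*From distance-heredity to the decomposition.* In a distance-hereditary graph the ends of an induced
`P4` have no common neighbour. Hence no outside vertex is adjacent to the module `A ∪ B ∪ H`, and
its complement contains no induced `P4` by the assumption on components. If `A` is joined to `B`,
then one of them, say `A`, has no edge to `H`, and the neighbours of `H` in `B` are a module that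
separates `H` from the other vertices of `A ∪ B ∪ H` and replaces `H` in the decomposition
(`IsGallSplit.exists_false`).

*From the decomposition to a network.* The cographs on `A ∪ H` and on `B ∪ H` have cotrees that
contain the same cotree of `H`, because a module of a cograph can be split off
(`P4FreeOn.exists_partition_of_isModule`). The Hasse diagram of the clusters of both cotrees,
with a hybrid vertex inserted above `H`, is the required arboreal network
(`IsTwoRootedFamily.explainedByArborealNetwork`).
-/

namespace ArborealNetworks

/-! ### Cographs are the graphs without an induced path on four vertices -/

section Cographs

variable {V : Type u}

/-- `a - b - c - d` is an induced path on four vertices. The six conditions force the four vertices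
to be distinct. -/
def IsInducedP4 (G : SimpleGraph V) (a b c d : V) : Prop :=
  G.Adj a b ∧ G.Adj b c ∧ G.Adj c d ∧ ¬ G.Adj a c ∧ ¬ G.Adj b d ∧ ¬ G.Adj a d

/-- `G[S]` contains no induced path on four vertices. -/
def P4FreeOn (G : SimpleGraph V) (S : Set V) : Prop :=
  ∀ a ∈ S, ∀ b ∈ S, ∀ c ∈ S, ∀ d ∈ S, ¬ IsInducedP4 G a b c d

lemma P4FreeOn.mono {G : SimpleGraph V} {S T : Set V} (h : P4FreeOn G T) (hST : S ⊆ T) :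
    P4FreeOn G S :=
  fun a ha b hb c hc d hd => h a (hST ha) b (hST hb) c (hST hc) d (hST hd)

lemma exists_inducedP4 {G : SimpleGraph V} {S : Set V} (h : ¬ P4FreeOn G S) :
    ∃ a ∈ S, ∃ b ∈ S, ∃ c ∈ S, ∃ d ∈ S, IsInducedP4 G a b c d := by
  simpa [P4FreeOn] using h

/-- An induced path on four vertices is connected, and so is its complement; hence it lies in one
class of any partition whose classes are pairwise completely joined, or pairwise non-adjacent. -/
lemma IsInducedP4.forall_rel {G : SimpleGraph V} {a b c d : V} (h : IsInducedP4 G a b c d)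
    {S : Set V} (ha : a ∈ S) (hb : b ∈ S) (hc : c ∈ S) (hd : d ∈ S) {r : V → V → Prop}
    (hsymm : ∀ x ∈ S, ∀ y ∈ S, r x y → r y x)
    (htrans : ∀ x ∈ S, ∀ y ∈ S, ∀ z ∈ S, r x y → r y z → r x z)
    {p : Prop} (hp : ∀ x ∈ S, ∀ y ∈ S, ¬ r x y → (G.Adj x y ↔ p)) :
    r a b ∧ r a c ∧ r a d := by
  obtain ⟨h1, h2, h3, h4, h5, h6⟩ := h
  by_cases hpp : p
  · have hp' : ∀ x ∈ S, ∀ y ∈ S, ¬ G.Adj x y → r x y := fun x hx y hy hn => by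
      by_contra hr
      exact hn ((hp x hx y hy hr).2 hpp)
    have r1 := hp' a ha c hc h4
    have r2 := hp' b hb d hd h5
    have r3 := hp' a ha d hd h6
    exact ⟨htrans a ha d hd b hb r3 (hsymm b hb d hd r2), r1, r3⟩
  · have hp' : ∀ x ∈ S, ∀ y ∈ S, G.Adj x y → r x y := fun x hx y hy hn => by
      by_contra hr
      exact hpp ((hp x hx y hy hr).1 hn)
    have r1 := hp' a ha b hb h1
    have r2 := hp' b hb c hc h2
    have r3 := hp' c hc d hd h3
    have r4 := htrans a ha b hb c hc r1 r2
    exact ⟨r1, r4, htrans a ha c hc d hd r4 r3⟩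

lemma P4FreeOn.union {G : SimpleGraph V} {A B : Set V} (hA : P4FreeOn G A) (hB : P4FreeOn G B)
    {p : Prop} (h : ∀ a ∈ A, ∀ b ∈ B, (G.Adj a b ↔ p)) : P4FreeOn G (A ∪ B) := by
  intro a ha b hb c hc d hd hP
  have key := hP.forall_rel (S := A ∪ B) (r := fun x y => x ∈ A ↔ y ∈ A) ha hb hc hd
    (fun x _ y _ h => h.symm) (fun x _ y _ z _ h h' => h.trans h') (p := p) (by
      intro x hx y hy hxy
      by_cases hxA : x ∈ A
      · have hyA : y ∉ A := fun hyA => hxy (by simp [hxA, hyA])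
        exact h x hxA y (hy.resolve_left hyA)
      · have hyA : y ∈ A := by
          by_contra hyA
          exact hxy (by simp [hxA, hyA])
        rw [G.adj_comm]
        exact h y hyA x (hx.resolve_left hxA))
  obtain ⟨k1, k2, k3⟩ := key
  by_cases haA : a ∈ A
  · exact hA a haA b (k1.1 haA) c (k2.1 haA) d (k3.1 haA) hP
  · exact hB a (ha.resolve_left haA) b (hb.resolve_left fun h => haA (k1.2 h))
      c (hc.resolve_left fun h => haA (k2.2 h)) d (hd.resolve_left fun h => haA (k3.2 h)) hP

lemma CographOn.nonempty {G : SimpleGraph V} {S : Set V} (h : CographOn G S) : S.Nonempty := by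
  induction h with
  | single v => exact Set.singleton_nonempty v
  | disjointUnion A B _ _ _ _ ihA _ => exact ihA.inl
  | joint A B _ _ _ _ ihA _ => exact ihA.inl

lemma CographOn.p4FreeOn {G : SimpleGraph V} {S : Set V} (h : CographOn G S) : P4FreeOn G S := by
  induction h with
  | single v =>
    rintro a rfl b rfl c rfl d rfl ⟨h1, -⟩
    exact G.irrefl h1
  | disjointUnion A B _ _ _ h ihA ihB =>
    exact ihA.union ihB (p := False) (by simpa using h)
  | joint A B _ _ _ h ihA ihB =>
    exact ihA.union ihB (p := True) (by simpa using h)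

lemma isInducedP4_compl {G : SimpleGraph V} {a b c d : V} (h : IsInducedP4 Gᶜ a b c d) :
    IsInducedP4 G b d a c := by
  obtain ⟨h1, h2, h3, h4, h5, h6⟩ := h
  have had : a ≠ d := by
    rintro rfl
    exact h4 h3.symm
  have hbd : b ≠ d := by
    rintro rfl
    exact h6 h1
  have hac : a ≠ c := by
    rintro rfl
    exact h6 h3
  simp only [SimpleGraph.compl_adj, not_and, not_not] at *
  exact ⟨h5 hbd, (h6 had).symm, h4 hac, fun h => h1.2 h.symm, fun h => h3.2 h.symm, h2.2⟩

lemma P4FreeOn.compl {G : SimpleGraph V} {S : Set V} (h : P4FreeOn G S) : P4FreeOn Gᶜ S :=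
  fun a ha b hb c hc d hd hP => h b hb d hd a ha c hc (isInducedP4_compl hP)

/-- One step of the theorem that `G[S]` or its complement is disconnected when `G[S]` is `P4`-free:
adding a vertex `v` to a disconnected graph. The set `Z` below consists of the non-neighbours of
`v` in one of the two sides; an edge leaving it within that side, together with a neighbour of `v`
in the other side, is an induced `P4`. -/
lemma exists_partition_insert {G : SimpleGraph V} {S X Y : Set V} {v : V}
    (hS : P4FreeOn G (insert v S)) (hv : v ∉ S) (hX : X.Nonempty) (hY : Y.Nonempty)
    (hXY : Disjoint X Y) (hU : X ∪ Y = S) (h : ∀ x ∈ X, ∀ y ∈ Y, ¬ G.Adj x y) :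
    ∃ X' Y' : Set V, X'.Nonempty ∧ Y'.Nonempty ∧ Disjoint X' Y' ∧ X' ∪ Y' = insert v S ∧
      ((∀ x ∈ X', ∀ y ∈ Y', ¬ G.Adj x y) ∨ (∀ x ∈ X', ∀ y ∈ Y', G.Adj x y)) := by
  by_cases hall : ∀ w ∈ S, G.Adj v w
  · refine ⟨{v}, S, Set.singleton_nonempty v, hU ▸ hX.inl, by simpa using hv, by simp, Or.inr ?_⟩
    rintro x rfl y hy
    exact hall y hy
  push Not at hall
  obtain ⟨w, hwS, hvw⟩ := hall
  wlog hwX : w ∈ X generalizing X Y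
  · refine this hY hX hXY.symm (by rw [Set.union_comm, hU])
      (fun x hx y hy hh => h y hy x hx hh.symm) ?_
    rw [← hU] at hwS
    exact hwS.resolve_left hwX
  have hXS : X ⊆ S := hU ▸ Set.subset_union_left
  have hYS : Y ⊆ S := hU ▸ Set.subset_union_right
  by_cases hYv : ∃ y ∈ Y, G.Adj v y
  · obtain ⟨y, hy, hvy⟩ := hYv
    refine ⟨{z ∈ X | ¬ G.Adj v z}, insert v (S \ {z ∈ X | ¬ G.Adj v z}), ⟨w, hwX, hvw⟩,
      ⟨v, Set.mem_insert _ _⟩, ?_, ?_, Or.inl ?_⟩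
    · rw [Set.disjoint_left]
      rintro z ⟨hz, hz'⟩ (rfl | hz'')
      · exact hv (hXS hz)
      · exact hz''.2 ⟨hz, hz'⟩
    · ext z
      have := @hXS z
      simp only [Set.mem_union, Set.mem_ofPred_eq, Set.mem_insert_iff, Set.mem_sdiff]
      tauto
    · rintro x ⟨hx, hvx⟩ z (rfl | ⟨hzS, hz⟩) hadj
      · exact hvx hadj.symm
      · rw [← hU] at hzS
        rcases hzS with hzX | hzY
        · have hvz : G.Adj v z := by
            by_contra hvz
            exact hz ⟨hzX, hvz⟩
          exact hS y (Or.inr (hYS hy)) v (Or.inl rfl) z (Or.inr (hXS hzX)) x (Or.inr (hXS hx))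
            ⟨hvy.symm, hvz, hadj.symm, fun hh => h z hzX y hy hh.symm, hvx,
              fun hh => h x hx y hy hh.symm⟩
        · exact h x hx z hzY hadj
  · push Not at hYv
    refine ⟨Y, insert v X, hY, ⟨v, Set.mem_insert _ _⟩, ?_, ?_, Or.inl ?_⟩
    · rw [Set.disjoint_left]
      rintro z hz (rfl | hz')
      · exact hv (hYS hz)
      · exact Set.disjoint_left.1 hXY hz' hz
    · rw [← hU, Set.union_insert, Set.union_comm]
    · rintro y hy x (rfl | hx) hadj
      · exact hYv y hy hadj.symm
      · exact h x hx y hy hadj.symm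

/-- A finite `P4`-free graph on at least two vertices is disconnected, or its complement is. -/
lemma P4FreeOn.exists_partition {G : SimpleGraph V} {S : Set V} (hfin : S.Finite)
    (hS : P4FreeOn G S) (hnt : S.Nontrivial) :
    ∃ X Y : Set V, X.Nonempty ∧ Y.Nonempty ∧ Disjoint X Y ∧ X ∪ Y = S ∧
      ((∀ x ∈ X, ∀ y ∈ Y, ¬ G.Adj x y) ∨ (∀ x ∈ X, ∀ y ∈ Y, G.Adj x y)) := by
  induction S, hfin using Set.Finite.induction_on with
  | empty => exact absurd hnt (by simp)
  | @insert v S hv hfin ih =>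
    by_cases hS1 : S.Nontrivial
    · obtain ⟨X, Y, hX, hY, hXY, hU, h | h⟩ := ih (hS.mono (Set.subset_insert v S)) hS1
      · exact exists_partition_insert hS hv hX hY hXY hU h
      · have hne : ∀ {X Y : Set V}, Disjoint X Y → ∀ x ∈ X, ∀ y ∈ Y, x ≠ y := by
          rintro X Y hXY x hx y hy rfl
          exact Set.disjoint_left.1 hXY hx hy
        obtain ⟨X', Y', h1, h2, h3, h4, h5⟩ := exists_partition_insert hS.compl hv hX hY hXY hU
          (fun x hx y hy => by simp [h x hx y hy])
        refine ⟨X', Y', h1, h2, h3, h4, h5.symm.imp ?_ ?_⟩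
        · intro h5 x hx y hy
          exact (SimpleGraph.compl_adj _ _ _).1 (h5 x hx y hy) |>.2
        · intro h5 x hx y hy
          by_contra hh
          exact h5 x hx y hy ((SimpleGraph.compl_adj _ _ _).2 ⟨hne h3 x hx y hy, hh⟩)
    · rw [Set.not_nontrivial_iff] at hS1
      have hSne : S.Nonempty := by
        rw [Set.nonempty_iff_ne_empty]
        rintro rfl
        simp at hnt
      obtain ⟨w, rfl⟩ := hS1.eq_empty_or_singleton.resolve_left hSne.ne_empty
      refine ⟨{v}, {w}, by simp, by simp, by simpa using hv, (Set.insert_eq v {w}).symm, ?_⟩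
      by_cases hvw : G.Adj v w <;> simp [hvw]

/-- A finite nonempty `P4`-free graph is a cograph. -/
lemma P4FreeOn.cographOn {G : SimpleGraph V} {S : Set V} (hfin : S.Finite) (hS : P4FreeOn G S)
    (hne : S.Nonempty) : CographOn G S := by
  induction hn : S.ncard using Nat.strong_induction_on generalizing S with
  | _ n ih =>
    by_cases hnt : S.Nontrivial
    · obtain ⟨X, Y, hX, hY, hXY, rfl, h⟩ := hS.exists_partition hfin hnt
      have hXf := hfin.subset (Set.subset_union_left (s := X) (t := Y))
      have hYf := hfin.subset (Set.subset_union_right (s := X) (t := Y))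
      have hcard := Set.ncard_union_eq hXY hXf hYf
      have h1 := (Set.ncard_pos hXf).2 hX
      have h2 := (Set.ncard_pos hYf).2 hY
      have cX := ih X.ncard (by omega) hXf (hS.mono Set.subset_union_left) hX rfl
      have cY := ih Y.ncard (by omega) hYf (hS.mono Set.subset_union_right) hY rfl
      rcases h with h | h
      · exact CographOn.disjointUnion X Y cX cY hXY h
      · exact CographOn.joint X Y cX cY hXY h
    · rw [Set.not_nontrivial_iff] at hnt
      obtain ⟨w, rfl⟩ := hnt.eq_empty_or_singleton.resolve_left hne.ne_empty
      exact CographOn.single w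

lemma isCograph_iff [Finite V] [Nonempty V] (G : SimpleGraph V) :
    IsCograph G ↔ P4FreeOn G Set.univ :=
  ⟨fun h => CographOn.p4FreeOn h, fun h => h.cographOn Set.finite_univ Set.univ_nonempty⟩

lemma isCograph_toSimpleGraph_iff [Finite V] {G : SimpleGraph V} (C : G.ConnectedComponent) :
    IsCograph C.toSimpleGraph ↔ P4FreeOn G C.supp := by
  have : Nonempty C := C.nonempty_supp.to_subtype
  rw [isCograph_iff]
  constructor
  · intro h a ha b hb c hc d hd hP
    exact h ⟨a, ha⟩ trivial ⟨b, hb⟩ trivial ⟨c, hc⟩ trivial ⟨d, hd⟩ trivial hP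
  · intro h a _ b _ c _ d _ hP
    exact h a a.2 b b.2 c c.2 d d.2 hP

lemma IsInducedP4.component_not_p4FreeOn {G : SimpleGraph V} {a b c d : V}
    (h : IsInducedP4 G a b c d) : ¬ P4FreeOn G (G.connectedComponentMk a).supp := by
  have hb : (G.Adj a b) := h.1
  have hc : G.Reachable a c := hb.reachable.trans h.2.1.reachable
  have hd : G.Reachable a d := hc.trans h.2.2.1.reachable
  refine fun hfree => hfree a rfl b ?_ c ?_ d ?_ h
  · exact SimpleGraph.ConnectedComponent.sound hb.reachable.symm
  · exact SimpleGraph.ConnectedComponent.sound hc.symm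
  · exact SimpleGraph.ConnectedComponent.sound hd.symm

end Cographs

/-! ### Two cographs sharing a module -/

section ModuleSplits

variable {V : Type u}

/-- `H` is a module of `G`: a vertex outside `H` is adjacent to all vertices of `H` or to none. -/
def IsModule (G : SimpleGraph V) (H : Set V) : Prop :=
  ∀ x ∉ H, ∀ h ∈ H, ∀ h' ∈ H, G.Adj x h → G.Adj x h'

/-- `V` is the disjoint union of `A`, `B` and a module `H`, no edge joins `A` to `B`, and the
induced subgraphs on `A ∪ H` and on `B ∪ H` are `P4`-free: `G` arises from two cographs that share
a vertex, with no edge between their remaining parts, by substituting `G[H]` for that vertex. -/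
structure IsModuleSplit (G : SimpleGraph V) (A B H : Set V) : Prop where
  cover : ∀ x, x ∈ A ∨ x ∈ B ∨ x ∈ H
  disjointAB : Disjoint A B
  disjointAH : Disjoint A H
  disjointBH : Disjoint B H
  not_adj : ∀ a ∈ A, ∀ b ∈ B, ¬ G.Adj a b
  isModule : IsModule G H
  freeA : P4FreeOn G (A ∪ H)
  freeB : P4FreeOn G (B ∪ H)

namespace IsModuleSplit

variable {G : SimpleGraph V} {A B H : Set V}

lemma symm (h : IsModuleSplit G A B H) : IsModuleSplit G B A H where
  cover x := by have := h.cover x; tauto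
  disjointAB := h.disjointAB.symm
  disjointAH := h.disjointBH
  disjointBH := h.disjointAH
  not_adj a ha b hb hab := h.not_adj b hb a ha hab.symm
  isModule := h.isModule
  freeA := h.freeB
  freeB := h.freeA

lemma free_union (h : IsModuleSplit G A B H) : P4FreeOn G (A ∪ B) :=
  (h.freeA.mono Set.subset_union_left).union (h.freeB.mono Set.subset_union_left) (p := False)
    (by simpa using h.not_adj)

lemma inter_A_nonempty (h : IsModuleSplit G A B H) {S : Set V} (hS : ¬ P4FreeOn G S) :
    (S ∩ A).Nonempty := by
  by_contra hne
  refine hS (h.freeB.mono fun x hx => ?_)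
  have hxA : x ∉ A := fun hxA => hne ⟨x, hx, hxA⟩
  exact (h.cover x).resolve_left hxA

lemma inter_H_nonempty (h : IsModuleSplit G A B H) {S : Set V} (hS : ¬ P4FreeOn G S) :
    (S ∩ H).Nonempty := by
  by_contra hne
  refine hS (h.free_union.mono fun x hx => ?_)
  have hxH : x ∉ H := fun hxH => hne ⟨x, hx, hxH⟩
  rcases h.cover x with h1 | h1 | h1
  exacts [Or.inl h1, Or.inr h1, (hxH h1).elim]

/-- A set inducing a non-cograph contains an edge from `A` to `H`. -/
lemma exists_adj (h : IsModuleSplit G A B H) {S : Set V} (hS : ¬ P4FreeOn G S) :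
    ∃ a ∈ S ∩ A, ∃ x ∈ S ∩ H, G.Adj a x := by
  by_contra hne
  push Not at hne
  have h1 : P4FreeOn G (S ∩ A) :=
    h.freeA.mono (Set.inter_subset_right.trans Set.subset_union_left)
  have h2 : P4FreeOn G (S ∩ (B ∪ H)) := h.freeB.mono Set.inter_subset_right
  refine hS ((h1.union h2 (p := False) ?_).mono ?_)
  · rintro a ha b ⟨hb, hbB | hbH⟩
    · simpa using h.not_adj a ha.2 b hbB
    · simpa using hne a ha b ⟨hb, hbH⟩
  · intro x hx
    rcases h.cover x with h1 | h1
    exacts [Or.inl ⟨hx, h1⟩, Or.inr ⟨hx, h1⟩]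

/-- The only component that is not a cograph is the one containing `H`. -/
lemma existsUnique_component [Finite V] [Nonempty V] (h : IsModuleSplit G A B H)
    (hG : ¬ IsCograph G) :
    ∃! C : G.ConnectedComponent, ¬ IsCograph C.toSimpleGraph := by
  rw [isCograph_iff] at hG
  obtain ⟨a, _, b, _, c, _, d, _, hP⟩ := exists_inducedP4 hG
  simp only [isCograph_toSimpleGraph_iff]
  have hsub : ∀ C : G.ConnectedComponent, ¬ P4FreeOn G C.supp → H ⊆ C.supp := by
    intro C hC x hx
    obtain ⟨a, ⟨haC, haA⟩, y, ⟨-, hyH⟩, hay⟩ := h.exists_adj hC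
    have haH : a ∉ H := Set.disjoint_left.1 h.disjointAH haA
    have hax := h.isModule a haH y hyH x hx hay
    exact (C.mem_supp_congr_adj hax).1 haC
  refine ⟨_, hP.component_not_p4FreeOn, fun C hC => ?_⟩
  obtain ⟨x, -, hx⟩ := h.inter_H_nonempty hC
  have h1 := hsub C hC hx
  have h2 := hsub _ hP.component_not_p4FreeOn hx
  exact h1.symm.trans h2

end IsModuleSplit

/-- The last step in building a connected cograph is a joint, so its diameter is at most two. -/
lemma CographOn.exists_common_neighbor {G : SimpleGraph V} {S : Set V} (h : CographOn G S)
    (hc : (G.induce S).Connected) {x y : V} (hx : x ∈ S) (hy : y ∈ S) (hxy : x ≠ y)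
    (hadj : ¬ G.Adj x y) : ∃ z ∈ S, G.Adj x z ∧ G.Adj z y := by
  cases h with
  | single v =>
    exact absurd ((Set.mem_singleton_iff.1 hx).trans (Set.mem_singleton_iff.1 hy).symm) hxy
  | disjointUnion A B hA hB hAB h =>
    exfalso
    obtain ⟨a, ha⟩ := hA.nonempty
    obtain ⟨b, hb⟩ := hB.nonempty
    obtain ⟨w⟩ := hc.preconnected ⟨a, Or.inl ha⟩ ⟨b, Or.inr hb⟩
    obtain ⟨d, -, hd1, hd2⟩ := w.exists_boundary_dart {z | (z : V) ∈ A} ha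
      (fun hbA => Set.disjoint_left.1 hAB hbA hb)
    exact h _ hd1 _ (d.snd.2.resolve_left hd2) d.adj
  | joint A B hA hB hAB h =>
    obtain ⟨a, ha⟩ := hA.nonempty
    obtain ⟨b, hb⟩ := hB.nonempty
    rcases hx with hx | hx <;> rcases hy with hy | hy
    · exact ⟨b, Or.inr hb, h x hx b hb, (h y hy b hb).symm⟩
    · exact absurd (h x hx y hy) hadj
    · exact absurd (h y hy x hx).symm hadj
    · exact ⟨a, Or.inl ha, (h a ha x hx).symm, h a ha y hy⟩

lemma two_le_dist {G : SimpleGraph V} {x y : V} (hr : G.Reachable x y) (hxy : x ≠ y)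
    (hadj : ¬ G.Adj x y) : 2 ≤ G.dist x y := by
  have h0 := hr.pos_dist_of_ne hxy
  have h1 : G.dist x y ≠ 1 := fun h => hadj (SimpleGraph.dist_eq_one_iff_adj.1 h)
  omega

lemma dist_le_dist_induce {G : SimpleGraph V} {S : Set V} (hc : (G.induce S).Connected)
    (x y : S) : G.dist (x : V) y ≤ (G.induce S).dist x y := by
  obtain ⟨w, hw⟩ := hc.exists_walk_length_eq_dist x y
  rw [← hw, ← w.length_map (SimpleGraph.Embedding.induce S).toHom]
  exact SimpleGraph.dist_le _

lemma reachable_of_induce {G : SimpleGraph V} {S : Set V} (hc : (G.induce S).Connected)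
    (x y : S) : G.Reachable (x : V) y :=
  (hc.preconnected x y).map (SimpleGraph.Embedding.induce S).toHom

lemma dist_induce_le_dist_induce {G : SimpleGraph V} {S T : Set V} (hST : S ⊆ T)
    (hc : (G.induce S).Connected) (x y : S) :
    (G.induce T).dist ⟨x, hST x.2⟩ ⟨y, hST y.2⟩ ≤ (G.induce S).dist x y := by
  obtain ⟨w, hw⟩ := hc.exists_walk_length_eq_dist x y
  rw [← hw, ← w.length_map (SimpleGraph.induceHomOfLE G hST).toHom]
  exact SimpleGraph.dist_le _

lemma dist_induce_le_two [Finite V] {G : SimpleGraph V} {S : Set V} (hS : P4FreeOn G S)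
    (hc : (G.induce S).Connected) (x y : S) : (G.induce S).dist x y ≤ 2 := by
  by_cases hxy : x = y
  · subst hxy
    simp
  by_cases hadj : G.Adj x y
  · have : (G.induce S).Adj x y := hadj
    rw [SimpleGraph.dist_eq_one_iff_adj.2 this]
    norm_num
  · have hcog := hS.cographOn S.toFinite ⟨x, x.2⟩
    obtain ⟨z, hz, hxz, hzy⟩ := hcog.exists_common_neighbor hc x.2 y.2
      (fun h => hxy (Subtype.ext h)) hadj
    have h1 : (G.induce S).Adj x ⟨z, hz⟩ := hxz
    have h2 : (G.induce S).Adj ⟨z, hz⟩ y := hzy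
    exact SimpleGraph.dist_le (SimpleGraph.Walk.cons h1 (SimpleGraph.Walk.cons h2 .nil))

lemma P4FreeOn.dist_eq [Finite V] {G : SimpleGraph V} {S : Set V} (hS : P4FreeOn G S)
    (hc : (G.induce S).Connected) (x y : S) : (G.induce S).dist x y = G.dist (x : V) y := by
  refine le_antisymm ?_ (dist_le_dist_induce hc x y)
  by_cases hxy : x = y
  · subst hxy
    simp
  have hxy' : (x : V) ≠ y := fun h => hxy (Subtype.ext h)
  by_cases hadj : G.Adj x y
  · have : (G.induce S).Adj x y := hadj
    rw [SimpleGraph.dist_eq_one_iff_adj.2 this, SimpleGraph.dist_eq_one_iff_adj.2 hadj]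
  · exact (dist_induce_le_two hS hc x y).trans
      (two_le_dist (reachable_of_induce hc x y) hxy' hadj)

namespace IsModuleSplit

variable {G : SimpleGraph V} {A B H : Set V}

/-- A connected set `S` meeting `A` and `H` stays connected when cut down to `A ∪ H`: a walk in `S`
leaves `A ∪ H` through `H`, and all of `S ∩ H` has a common neighbour in `S ∩ A`. -/
lemma connected_inter (h : IsModuleSplit G A B H) {S : Set V} (hc : (G.induce S).Connected)
    (hA : (S ∩ A).Nonempty) (hH : (S ∩ H).Nonempty) :
    (G.induce (S ∩ (A ∪ H))).Connected := by
  obtain ⟨a₀, ha₀S, ha₀⟩ := hA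
  obtain ⟨h₀, hh₀S, hh₀⟩ := hH
  have hAH := Set.disjoint_left.1 h.disjointAH
  have step : ∀ {z z' : V}, z ∈ A → G.Adj z z' → z' ∈ A ∪ H := by
    intro z z' hz hadj
    rcases h.cover z' with h1 | h1 | h1
    exacts [Or.inl h1, (h.not_adj z hz z' h1 hadj).elim, Or.inr h1]
  -- some vertex `a₁` of `S ∩ A` is adjacent to a vertex of `H`, hence to all of them
  obtain ⟨a₁, ha₁S, ha₁, hadj₁⟩ : ∃ a ∈ S, a ∈ A ∧ ∀ x ∈ H, G.Adj a x := by
    obtain ⟨w⟩ := hc.preconnected ⟨a₀, ha₀S⟩ ⟨h₀, hh₀S⟩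
    obtain ⟨d, -, hd1, hd2⟩ := w.exists_boundary_dart {z | (z : V) ∈ A} ha₀
      (fun hA => hAH hA hh₀)
    have hadj : G.Adj d.fst d.snd := d.adj
    have hd3 : (d.snd : V) ∈ H := (step hd1 hadj).resolve_left hd2
    exact ⟨d.fst, d.fst.2, hd1, fun x hx => h.isModule _ (hAH hd1) _ hd3 x hx hadj⟩
  have hmem₁ : a₁ ∈ S ∩ (A ∪ H) := ⟨ha₁S, Or.inl ha₁⟩
  have reachH : ∀ x (hx : x ∈ S ∩ (A ∪ H)), x ∈ H →
      (G.induce (S ∩ (A ∪ H))).Reachable ⟨x, hx⟩ ⟨a₁, hmem₁⟩ := by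
    intro x hx hxH
    have : (G.induce (S ∩ (A ∪ H))).Adj ⟨x, hx⟩ ⟨a₁, hmem₁⟩ := (hadj₁ x hxH).symm
    exact this.reachable
  have key : ∀ (z y : S) (_ : (G.induce S).Walk z y) (hz : (z : V) ∈ S ∩ (A ∪ H)),
      (y : V) ∈ H → (G.induce (S ∩ (A ∪ H))).Reachable ⟨z, hz⟩ ⟨a₁, hmem₁⟩ := by
    intro z y w
    induction w with
    | nil => exact fun hz hH => reachH _ hz hH
    | @cons z z' y hadj w ih =>
      intro hz hy
      by_cases hzH : (z : V) ∈ H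
      · exact reachH _ hz hzH
      · have hadj' : G.Adj z z' := hadj
        have hz' : (z' : V) ∈ S ∩ (A ∪ H) := ⟨z'.2, step (hz.2.resolve_right hzH) hadj'⟩
        have : (G.induce (S ∩ (A ∪ H))).Adj ⟨z, hz⟩ ⟨z', hz'⟩ := hadj'
        exact this.reachable.trans (ih hz' hy)
  rw [SimpleGraph.connected_iff_exists_forall_reachable]
  refine ⟨⟨a₁, hmem₁⟩, fun z => ?_⟩
  obtain ⟨w⟩ := hc.preconnected ⟨z, z.2.1⟩ ⟨h₀, hh₀S⟩
  exact (key _ _ w z.2 hh₀).symm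

/-- The distance from a vertex of `A` to `H` within a connected set `S` is at most the distance in
`G`, even when the nearest vertices of `H` are missing from `S`: it is one or two, according to
adjacency with the module `H`. -/
lemma dist_induce_le [Finite V] (h : IsModuleSplit G A B H) {S : Set V}
    (hc : (G.induce S).Connected) {x h' : V} (hx : x ∈ S) (hxA : x ∈ A) (hh' : h' ∈ S)
    (hh'H : h' ∈ H) {y : V} (hyH : y ∈ H) (hr : G.Reachable x y) :
    (G.induce S).dist ⟨x, hx⟩ ⟨h', hh'⟩ ≤ G.dist x y := by
  have hAH := Set.disjoint_left.1 h.disjointAH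
  have hc' := h.connected_inter hc ⟨x, hx, hxA⟩ ⟨h', hh', hh'H⟩
  have hfree : P4FreeOn G (S ∩ (A ∪ H)) := h.freeA.mono Set.inter_subset_right
  refine (dist_induce_le_dist_induce Set.inter_subset_left hc' ⟨x, hx, Or.inl hxA⟩
    ⟨h', hh', Or.inr hh'H⟩).trans ?_
  have hxy : x ≠ y := fun e => hAH hxA (e ▸ hyH)
  by_cases hadj : G.Adj x y
  · have hadj' := h.isModule x (hAH hxA) y hyH h' hh'H hadj
    rw [hfree.dist_eq hc', SimpleGraph.dist_eq_one_iff_adj.2 hadj,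
      SimpleGraph.dist_eq_one_iff_adj.2 hadj']
  · exact (dist_induce_le_two hfree hc' _ _).trans (two_le_dist hr hxy hadj)

lemma isDistanceHereditary [Finite V] (h : IsModuleSplit G A B H) : IsDistanceHereditary G := by
  intro S hc x y
  by_cases hS : P4FreeOn G S
  · exact (hS.dist_eq hc x y).symm
  -- a pair inside `A ∪ H`, respectively inside `B ∪ H`, is settled within a connected cograph
  have inside : ∀ {A B : Set V}, IsModuleSplit G A B H → (x : V) ∈ A ∪ H → (y : V) ∈ A ∪ H →
      G.dist (x : V) y = (G.induce S).dist x y := by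
    intro A B h hx hy
    have hc' := h.connected_inter hc (h.inter_A_nonempty hS) (h.inter_H_nonempty hS)
    have hfree : P4FreeOn G (S ∩ (A ∪ H)) := h.freeA.mono Set.inter_subset_right
    refine le_antisymm (dist_le_dist_induce hc x y) ?_
    have h1 := dist_induce_le_dist_induce Set.inter_subset_left hc'
      (⟨x, x.2, hx⟩ : ↥(S ∩ (A ∪ H))) ⟨y, y.2, hy⟩
    rw [hfree.dist_eq hc'] at h1
    exact h1
  -- a walk from `A` to `B` passes through `H`
  have across : ∀ {A B : Set V}, IsModuleSplit G A B H → (x : V) ∈ A → (y : V) ∈ B →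
      G.dist (x : V) y = (G.induce S).dist x y := by
    classical
    intro A B h hx hy
    refine le_antisymm (dist_le_dist_induce hc x y) ?_
    obtain ⟨h', hh'S, hh'⟩ := h.inter_H_nonempty hS
    obtain ⟨w, hw⟩ := (reachable_of_induce hc x y).exists_walk_length_eq_dist
    obtain ⟨d, hd, hd1, hd2⟩ := w.exists_boundary_dart A hx
      (fun hA => Set.disjoint_left.1 h.disjointAB hA hy)
    have hdH : d.snd ∈ H := by
      rcases h.cover d.snd with h1 | h1 | h1
      exacts [(hd2 h1).elim, (h.not_adj _ hd1 _ h1 d.adj).elim, h1]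
    have hsup := w.dart_snd_mem_support_of_mem_darts hd
    have hlen : G.dist (x : V) d.snd + G.dist d.snd y ≤ G.dist (x : V) y := by
      rw [← hw, ← congrArg SimpleGraph.Walk.length (w.take_spec hsup),
        SimpleGraph.Walk.length_append]
      exact add_le_add (SimpleGraph.dist_le _) (SimpleGraph.dist_le _)
    have h1 := h.dist_induce_le hc x.2 hx hh'S hh' hdH ⟨w.takeUntil _ hsup⟩
    have h2 := h.symm.dist_induce_le hc y.2 hy hh'S hh' hdH ⟨(w.dropUntil _ hsup).reverse⟩
    rw [SimpleGraph.dist_comm, SimpleGraph.dist_comm (G := G)] at h2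
    exact (hc.dist_triangle (v := ⟨h', hh'S⟩)).trans ((add_le_add h1 h2).trans hlen)
  rcases h.cover x with hx | hx | hx <;> rcases h.cover y with hy | hy | hy
  · exact inside h (Or.inl hx) (Or.inl hy)
  · exact across h hx hy
  · exact inside h (Or.inl hx) (Or.inr hy)
  · exact across h.symm hx hy
  · exact inside h.symm (Or.inl hx) (Or.inl hy)
  · exact inside h.symm (Or.inl hx) (Or.inr hy)
  · exact inside h (Or.inr hx) (Or.inl hy)
  · exact inside h.symm (Or.inr hx) (Or.inl hy)
  · exact inside h (Or.inr hx) (Or.inr hy)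

end IsModuleSplit

end ModuleSplits

/-! ### Ancestors and entering edges in acyclic digraphs -/

section Digraphs

variable {W : Type u} {N : Digraph W}

/-- No directed closed walk of positive length. -/
def IsAcyclicDigraph (N : Digraph W) : Prop := ∀ v, ¬ Relation.TransGen N.Adj v v

/-- The edge `(a, b)` enters the set of descendants of `q`. -/
def Enters (N : Digraph W) (q a b : W) : Prop :=
  N.Adj a b ∧ ¬ IsAncestor N q a ∧ IsAncestor N q b

lemma IsAncestor.refl (u : W) : IsAncestor N u u := Relation.ReflTransGen.refl

lemma IsAncestor.trans {u v w : W} (h : IsAncestor N u v) (h' : IsAncestor N v w) :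
    IsAncestor N u w := Relation.ReflTransGen.trans h h'

lemma isAncestor_of_adj {u v : W} (h : N.Adj u v) : IsAncestor N u v :=
  Relation.ReflTransGen.single h

lemma IsAncestor.exists_child {u v : W} (h : IsAncestor N u v) (hne : u ≠ v) :
    ∃ c, N.Adj u c ∧ IsAncestor N c v :=
  (Relation.ReflTransGen.cases_head h).resolve_left hne

lemma IsAncestor.exists_parent {u v : W} (h : IsAncestor N u v) (hne : u ≠ v) :
    ∃ c, N.Adj c v ∧ IsAncestor N u c := by
  obtain ⟨c, h1, h2⟩ := (Relation.ReflTransGen.cases_tail h).resolve_left hne.symm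
  exact ⟨c, h2, h1⟩

namespace IsAcyclicDigraph

lemma not_adj_ancestor (hN : IsAcyclicDigraph N) {u v : W} (h : N.Adj u v) :
    ¬ IsAncestor N v u :=
  fun h' => hN u (Relation.TransGen.head' h h')

lemma antisymm (hN : IsAcyclicDigraph N) {u v : W} (h : IsAncestor N u v)
    (h' : IsAncestor N v u) : u = v := by
  by_contra hne
  obtain ⟨c, hc, hcv⟩ := h.exists_child hne
  exact hN.not_adj_ancestor hc (hcv.trans h')

lemma ne (hN : IsAcyclicDigraph N) {u v : W} (h : N.Adj u v) : u ≠ v := by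
  rintro rfl
  exact hN.not_adj_ancestor h (IsAncestor.refl _)

lemma wellFounded [Finite W] (hN : IsAcyclicDigraph N) : WellFounded N.Adj := by
  have : Std.Irrefl (Relation.TransGen N.Adj) := ⟨hN⟩
  exact Subrelation.wf (fun h => Relation.TransGen.single h)
    (Finite.wellFounded_of_trans_of_irrefl (Relation.TransGen N.Adj))

lemma wellFounded_swap [Finite W] (hN : IsAcyclicDigraph N) :
    WellFounded fun a b => N.Adj b a := by
  have : Std.Irrefl (Function.swap (Relation.TransGen N.Adj)) := ⟨hN⟩
  exact Subrelation.wf (r := Function.swap (Relation.TransGen N.Adj))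
    (fun h => Relation.TransGen.single h)
    (Finite.wellFounded_of_trans_of_irrefl (Function.swap (Relation.TransGen N.Adj)))

lemma exists_isPath (hN : IsAcyclicDigraph N) {u v : W} (h : IsAncestor N u v) :
    ∃ w : N.toSimpleGraphInclusive.Walk u v, w.IsPath ∧
      ∀ z ∈ w.support, IsAncestor N u z ∧ IsAncestor N z v := by
  induction h with
  | refl => exact ⟨.nil, .nil, by simp [IsAncestor.refl]⟩
  | @tail b c hub hbc ih =>
    obtain ⟨w, hw, hsup⟩ := ih
    have hadj : N.toSimpleGraphInclusive.Adj b c := ⟨hN.ne hbc, Or.inl hbc⟩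
    refine ⟨w.concat hadj, hw.concat (fun hc => ?_) hadj, ?_⟩
    · exact hN.not_adj_ancestor hbc (hsup c hc).2
    · intro z hz
      rw [SimpleGraph.Walk.support_concat, List.mem_append,
        List.mem_singleton] at hz
      rcases hz with hz | rfl
      · exact ⟨(hsup z hz).1, (hsup z hz).2.trans (isAncestor_of_adj hbc)⟩
      · exact ⟨Relation.ReflTransGen.tail hub hbc, IsAncestor.refl _⟩

/-- In a network whose underlying graph is a tree, two distinct parents of a vertex have no common
ancestor: otherwise there would be two paths from that ancestor to the vertex. -/
lemma parent_unique (hN : IsAcyclicDigraph N) (hT : N.toSimpleGraphInclusive.IsAcyclic)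
    {v p p' w : W} (hp : N.Adj p w) (hp' : N.Adj p' w) (h : IsAncestor N v p)
    (h' : IsAncestor N v p') : p = p' := by
  have extend : ∀ {p : W}, N.Adj p w → IsAncestor N v p →
      ∃ q : N.toSimpleGraphInclusive.Walk v w, q.IsPath ∧ q.penultimate = p := by
    intro p hp h
    obtain ⟨q, hq, hsup⟩ := hN.exists_isPath h
    have hadj : N.toSimpleGraphInclusive.Adj p w := ⟨hN.ne hp, Or.inl hp⟩
    exact ⟨q.concat hadj, hq.concat (fun hc => hN.not_adj_ancestor hp (hsup w hc).2) hadj,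
      SimpleGraph.Walk.penultimate_concat _ _⟩
  obtain ⟨q, hq, e⟩ := extend hp h
  obtain ⟨q', hq', e'⟩ := extend hp' h'
  have hqq : q = q' := congrArg Subtype.val
    ((hT.subsingleton_path v w).elim ⟨q, hq⟩ ⟨q', hq'⟩)
  rw [← e, ← e', hqq]

end IsAcyclicDigraph

/-- A directed path to a descendant of `q` that starts outside the descendants of `q` enters them
through an edge. -/
lemma exists_enters {u q z : W} (h : IsAncestor N u z) (hq : IsAncestor N q z)
    (hu : ¬ IsAncestor N q u) :
    ∃ a b, IsAncestor N u a ∧ Enters N q a b ∧ IsAncestor N b z := by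
  induction h using Relation.ReflTransGen.head_induction_on with
  | refl => exact absurd hq hu
  | @head u c huc hcz ih =>
    by_cases hc : IsAncestor N q c
    · exact ⟨u, c, IsAncestor.refl u, ⟨huc, hu, hc⟩, hcz⟩
    · obtain ⟨a, b, h1, h2, h3⟩ := ih hc
      exact ⟨a, b, (isAncestor_of_adj huc).trans h1, h2, h3⟩

end Digraphs

/-! ### The block of an edge -/

section Blocks

variable {W : Type u} (G : SimpleGraph W)

/-- The vertices `z` that no other vertex `x` separates from the edge `pq`: some walk from `z` to
`p` or to `q` avoids `x`. -/
def edgeBlock (p q : W) : Set W :=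
  {z | ∀ x, x ≠ z → ∃ b, (b = p ∨ b = q) ∧ ∃ w : G.Walk z b, x ∉ w.support}

variable {G}

/-- If `u` lies on a path from `z` to an end of `pq`, then a vertex `x` separating `u` from `pq`
occurs after `u` on this path, hence not before `u`, and so it separates `z` from `pq` as well. -/
lemma mem_edgeBlock_of_isPath {p q z b u : W} (hz : z ∈ edgeBlock G p q) (hb : b = p ∨ b = q)
    {w : G.Walk z b} (hw : w.IsPath) (hu : u ∈ w.support) : u ∈ edgeBlock G p q := by
  obtain ⟨w₁, w₂, rfl⟩ := SimpleGraph.Walk.mem_support_iff_exists_append.1 hu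
  intro x hxu
  by_cases hx₂ : x ∈ w₂.support
  · have hx₁ : x ∉ w₁.support := fun hx₁ =>
      hw.ne_of_mem_support_of_append hxu hx₁ hx₂ rfl
    obtain ⟨b', hb', w', hw'⟩ := hz x fun h => hx₁ (h ▸ w₁.start_mem_support)
    refine ⟨b', hb', w₁.reverse.append w', ?_⟩
    simp [SimpleGraph.Walk.mem_support_append_iff, hx₁, hw']
  · exact ⟨b, hb, w₂, hx₂⟩

lemma edgeBlock_connected {p q : W} (hpq : G.Adj p q) (x : W) :
    (G.induce (edgeBlock G p q \ {x})).Connected := by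
  classical
  have hp : p ∈ edgeBlock G p q := fun y hy => ⟨p, Or.inl rfl, .nil, by simpa using hy⟩
  have hq : q ∈ edgeBlock G p q := fun y hy => ⟨q, Or.inr rfl, .nil, by simpa using hy⟩
  have key : ∀ z (hz : z ∈ edgeBlock G p q \ {x}), ∃ b, ∃ hb : b ∈ edgeBlock G p q \ {x},
      (b = p ∨ b = q) ∧ (G.induce (edgeBlock G p q \ {x})).Reachable ⟨z, hz⟩ ⟨b, hb⟩ := by
    intro z hz
    obtain ⟨b, hb, w, hw⟩ := hz.1 x fun h => hz.2 h.symm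
    have hsup : ∀ u ∈ w.bypass.support, u ∈ edgeBlock G p q \ {x} := by
      intro u hu
      refine ⟨mem_edgeBlock_of_isPath hz.1 hb w.bypass_isPath hu, ?_⟩
      rintro rfl
      exact hw (w.support_bypass_subset_support hu)
    exact ⟨b, hsup b (SimpleGraph.Walk.end_mem_support _), hb, ⟨w.bypass.induce _ hsup⟩⟩
  have hends : ∀ b b' (hb : b ∈ edgeBlock G p q \ {x}) (hb' : b' ∈ edgeBlock G p q \ {x}),
      (b = p ∨ b = q) → (b' = p ∨ b' = q) →
      (G.induce (edgeBlock G p q \ {x})).Reachable ⟨b, hb⟩ ⟨b', hb'⟩ := by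
    intro b b' hb hb' h h'
    by_cases hbb : b = b'
    · subst hbb
      rfl
    · have : (G.induce (edgeBlock G p q \ {x})).Adj ⟨b, hb⟩ ⟨b', hb'⟩ := by
        rcases h with rfl | rfl <;> rcases h' with rfl | rfl
        exacts [(hbb rfl).elim, hpq, hpq.symm, (hbb rfl).elim]
      exact this.reachable
  have : Nonempty ↥(edgeBlock G p q \ {x}) := by
    by_cases hpx : p = x
    · exact ⟨⟨q, hq, fun h => hpq.ne (hpx.trans h.symm)⟩⟩
    · exact ⟨⟨p, hp, hpx⟩⟩
  refine ⟨fun y z => ?_⟩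
  obtain ⟨b, hb, hbe, hyb⟩ := key y y.2
  obtain ⟨b', hb', hbe', hzb⟩ := key z z.2
  exact hyb.trans ((hends b b' hb hb' hbe hbe').trans hzb.symm)

end Blocks

/-! ### Edges entering sets of descendants in a galled-tree -/

section Galled

variable {W : Type u} {N : Digraph W}

/-- The shape of a galled-tree as it is used below: an acyclic digraph with a vertex above all
others in which, for every edge `(p, q)`, at most one further edge enters the set of descendants
of `q`. -/
structure IsGalledShape (N : Digraph W) : Prop where
  acyclic : IsAcyclicDigraph N
  exists_root : ∃ r, ∀ v, IsAncestor N r v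
  enters_unique : ∀ {p q a b a' b' : W}, N.Adj p q → Enters N q a b → ¬ (a = p ∧ b = q) →
    Enters N q a' b' → ¬ (a' = p ∧ b' = q) → a = a' ∧ b = b'

lemma indeg_eq_zero_iff [Finite W] {v : W} : indeg N v = 0 ↔ ∀ p, ¬ N.Adj p v := by
  rw [indeg, Set.ncard_eq_zero (Set.toFinite _), Set.eq_empty_iff_forall_notMem]
  rfl

lemma outdeg_eq_zero_iff [Finite W] {v : W} : outdeg N v = 0 ↔ ∀ c, ¬ N.Adj v c := by
  rw [outdeg, Set.ncard_eq_zero (Set.toFinite _), Set.eq_empty_iff_forall_notMem]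
  rfl

lemma two_le_outdeg [Finite W] {v c c' : W} (hc : N.Adj v c) (hc' : N.Adj v c') (hne : c ≠ c') :
    2 ≤ outdeg N v :=
  (Set.one_lt_ncard (Set.toFinite _)).2 ⟨c, hc, c', hc', hne⟩

lemma two_le_indeg [Finite W] {v p p' : W} (hp : N.Adj p v) (hp' : N.Adj p' v) (hne : p ≠ p') :
    2 ≤ indeg N v :=
  (Set.one_lt_ncard (Set.toFinite _)).2 ⟨p, hp, p', hp', hne⟩

lemma three_le_indeg [Finite W] {v p₁ p₂ p₃ : W} (h₁ : N.Adj p₁ v) (h₂ : N.Adj p₂ v)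
    (h₃ : N.Adj p₃ v) (h₁₂ : p₁ ≠ p₂) (h₁₃ : p₁ ≠ p₃) (h₂₃ : p₂ ≠ p₃) : 3 ≤ indeg N v :=
  (Set.two_lt_ncard (Set.toFinite _)).2 ⟨p₁, h₁, p₂, h₂, p₃, h₃, h₁₂, h₁₃, h₂₃⟩

lemma IsAcyclicDigraph.exists_root_ancestor [Finite W] (hN : IsAcyclicDigraph N) (v : W) :
    ∃ r ∈ roots N, IsAncestor N r v := by
  induction v using hN.wellFounded.induction with
  | _ v ih =>
    by_cases hv : ∃ p, N.Adj p v
    · obtain ⟨p, hp⟩ := hv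
      obtain ⟨r, hr, hrp⟩ := ih p hp
      exact ⟨r, hr, hrp.trans (isAncestor_of_adj hp)⟩
    · push Not at hv
      exact ⟨v, indeg_eq_zero_iff.2 hv, IsAncestor.refl v⟩

/-- The head of an edge entering the descendants of `q` has a parent other than the tail. -/
lemma Enters.exists_other_parent {p q a b : W} (hpq : N.Adj p q) (h : Enters N q a b)
    (hne : ¬ (a = p ∧ b = q)) :
    ∃ c, N.Adj c b ∧ c ≠ a ∧ (IsAncestor N q c ∨ (c = p ∧ b = q)) := by
  by_cases hb : b = q
  · subst hb
    exact ⟨p, hpq, fun e => hne ⟨e.symm, rfl⟩, Or.inr ⟨rfl, rfl⟩⟩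
  · obtain ⟨c, hc, hqc⟩ := h.2.2.exists_parent (Ne.symm hb)
    exact ⟨c, hc, fun e => h.2.1 (e ▸ hqc), Or.inl hqc⟩

/-- The head of an edge entering the descendants of `q` is in the block of every edge `pq`: it
reaches `q` inside the descendants of `q`, and `p` outside them, by way of the root. -/
lemma Enters.mem_edgeBlock (hN : IsAcyclicDigraph N) (hr : ∃ r, ∀ v, IsAncestor N r v)
    {p q a b : W} (hpq : N.Adj p q) (h : Enters N q a b) :
    b ∈ edgeBlock N.toSimpleGraphInclusive p q := by
  intro x hxb
  by_cases hx : IsAncestor N q x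
  · obtain ⟨r, hr⟩ := hr
    obtain ⟨w₁, -, hw₁⟩ := hN.exists_isPath (hr a)
    obtain ⟨w₂, -, hw₂⟩ := hN.exists_isPath (hr p)
    have hadj : N.toSimpleGraphInclusive.Adj b a := ⟨(hN.ne h.1).symm, Or.inr h.1⟩
    refine ⟨p, Or.inl rfl, .cons hadj (w₁.reverse.append w₂), ?_⟩
    have h1 : x ∉ w₁.support := fun hx' => h.2.1 (hx.trans (hw₁ x hx').2)
    have h2 : x ∉ w₂.support := fun hx' => hN.not_adj_ancestor hpq (hx.trans (hw₂ x hx').2)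
    simp [SimpleGraph.Walk.mem_support_append_iff, h1, h2, hxb]
  · obtain ⟨w, -, hw⟩ := hN.exists_isPath h.2.2
    exact ⟨q, Or.inr rfl, w.reverse, fun hx' => hx (hw x (by simpa using hx')).1⟩

/-- If two further edges entered the descendants of `q`, then their heads would be two vertices of
indegree two in one block. -/
lemma IsGalledTree.isGalledShape [Finite W] (h : IsGalledTree N) : IsGalledShape N := by
  obtain ⟨⟨hnet, r, hr, hru⟩, hdeg, hblock⟩ := h
  have hN : IsAcyclicDigraph N := hnet.acyclic
  have hroot : ∃ r, ∀ v, IsAncestor N r v := by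
    refine ⟨r, fun v => ?_⟩
    obtain ⟨r', hr', hv⟩ := hN.exists_root_ancestor v
    exact hru r' hr' ▸ hv
  refine ⟨hN, hroot, ?_⟩
  intro p q a b a' b' hpq he hne he' hne'
  by_cases hbb : b = b'
  · subst hbb
    refine ⟨?_, rfl⟩
    by_contra haa
    obtain ⟨c, hc, hca, h1⟩ := he.exists_other_parent hpq hne
    have hca' : c ≠ a' := by
      rintro rfl
      rcases h1 with h1 | h1
      exacts [he'.2.1 h1, hne' h1]
    have := three_le_indeg he.1 he'.1 hc haa hca.symm hca'.symm
    have := hdeg b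
    omega
  · exfalso
    have hdeg2 : ∀ {a b : W}, Enters N q a b → ¬ (a = p ∧ b = q) → indeg N b = 2 := by
      intro a b he hne
      obtain ⟨c, hc, hca, -⟩ := he.exists_other_parent hpq hne
      exact le_antisymm (hdeg b) (two_le_indeg he.1 hc hca.symm)
    have hb := he.mem_edgeBlock hN hroot hpq
    have hb' := he'.mem_edgeBlock hN hroot hpq
    have hp : p ∈ edgeBlock N.toSimpleGraphInclusive p q :=
      fun y hy => ⟨p, Or.inl rfl, .nil, by simpa using hy⟩
    have hbp : ∀ {a b : W}, Enters N q a b → p ≠ b := by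
      rintro a b he rfl
      exact hN.not_adj_ancestor hpq he.2.2
    have hadj : N.toSimpleGraphInclusive.Adj p q := ⟨hN.ne hpq, Or.inl hpq⟩
    have hbi : BiconnectedOn N.toSimpleGraphInclusive
        (edgeBlock N.toSimpleGraphInclusive p q) :=
      ⟨(Set.two_lt_ncard (Set.toFinite _)).2 ⟨p, hp, b, hb, b', hb', hbp he, hbp he', hbb⟩,
        fun x _ => edgeBlock_connected hadj x⟩
    obtain ⟨C, hC, hmax⟩ := Finite.exists_le_maximal hbi
    have h1 := hblock C hmax
    have h2 : 1 < {v | v ∈ C ∧ indeg N v = 2}.ncard :=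
      (Set.one_lt_ncard (Set.toFinite _)).2
        ⟨b, ⟨hC hb, hdeg2 he hne⟩, b', ⟨hC hb', hdeg2 he' hne'⟩, hbb⟩
    omega

end Galled

/-! ### Linked children in a galled-tree -/

section GalledShape

variable {W : Type u} {N : Digraph W}

/-- `c` and `c'` have a common descendant. -/
def Linked (N : Digraph W) (c c' : W) : Prop := ∃ z, IsAncestor N c z ∧ IsAncestor N c' z

lemma Linked.symm {c c' : W} (h : Linked N c c') : Linked N c' c :=
  let ⟨z, h1, h2⟩ := h
  ⟨z, h2, h1⟩

lemma IsLCA.eq_of_isAncestor {u w x y : W} (h : IsLCA N u x y) (huw : IsAncestor N u w)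
    (hx : IsAncestor N w x) (hy : IsAncestor N w y) : u = w := by
  by_contra hne
  obtain ⟨c, hc, hcw⟩ := huw.exists_child hne
  exact h.2.2 c hc ⟨hcw.trans hx, hcw.trans hy⟩

namespace IsGalledShape

/-- Least common ancestors are unique: if `u` and `v` are two of them, the paths from `u` to `x` and
to `y` enter the descendants of `v` through the same edge, whose head is a lower common
ancestor. -/
lemma lca_unique (hN : IsGalledShape N) {u v x y : W} (hu : IsLCA N u x y)
    (hv : IsLCA N v x y) : u = v := by
  by_contra hne
  have huv : ¬ IsAncestor N u v := fun h => hne (hu.eq_of_isAncestor h hv.1 hv.2.1)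
  have hvu : ¬ IsAncestor N v u := fun h => hne (hv.eq_of_isAncestor h hu.1 hu.2.1).symm
  obtain ⟨r, hr⟩ := hN.exists_root
  obtain ⟨p, hp, -⟩ := (hr v).exists_parent (fun h => hvu (h ▸ hr u))
  obtain ⟨a, b, hua, hab, hbx⟩ := exists_enters hu.1 hv.1 hvu
  obtain ⟨a', b', hua', hab', hby⟩ := exists_enters hu.2.1 hv.2.1 hvu
  have hbv : ∀ {a b : W}, IsAncestor N u a → Enters N v a b → b ≠ v := by
    rintro a b h1 h2 rfl
    exact huv (h1.trans (isAncestor_of_adj h2.1))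
  obtain ⟨-, rfl⟩ := hN.enters_unique hp hab (fun h => hbv hua hab h.2) hab'
    (fun h => hbv hua' hab' h.2)
  exact hbv hua hab (hv.eq_of_isAncestor hab.2.2 hbx hby).symm

/-- All directed paths to the descendants of a vertex with two parents pass through it. -/
lemma isAncestor_of_two_parents (hN : IsGalledShape N) {w w₁ w₂ z h : W} (hne : w₁ ≠ w₂)
    (h₁ : N.Adj w₁ w) (h₂ : N.Adj w₂ w) (hzh : IsAncestor N z h) (hwh : IsAncestor N w h)
    (hwz : ¬ IsAncestor N w z) : IsAncestor N z w := by
  obtain ⟨a, b, hza, hab, -⟩ := exists_enters hzh hwh hwz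
  by_cases h : a = w₁ ∧ b = w
  · exact h.2 ▸ hza.trans (isAncestor_of_adj hab.1)
  · have := hN.enters_unique h₁ hab h
      (⟨h₂, hN.acyclic.not_adj_ancestor h₂, IsAncestor.refl w⟩ : Enters N w w₂ w)
      (fun h => hne h.1.symm)
    exact this.2 ▸ hza.trans (isAncestor_of_adj hab.1)

/-- If the children `c` and `c'` of `v` are linked, then besides `(v, c)` a second edge enters the
descendants of `c`. It is `(v, c')` if `c'` is below `c`; otherwise it starts below `c'` and its
head is above all common descendants of `c` and `c'`. -/
lemma exists_second_enters (hN : IsGalledShape N) {v c c' : W} (hc : N.Adj v c)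
    (hc' : N.Adj v c') (hne : c ≠ c') (hl : Linked N c c') :
    ∃ a b, Enters N c a b ∧ ¬ (a = v ∧ b = c) ∧
      ((IsAncestor N c c' ∧ a = v ∧ b = c') ∨
        (¬ IsAncestor N c c' ∧ IsAncestor N c' a ∧
          ∀ z, IsAncestor N c z → IsAncestor N c' z → IsAncestor N b z)) := by
  by_cases hcc : IsAncestor N c c'
  · exact ⟨v, c', ⟨hc', hN.acyclic.not_adj_ancestor hc, hcc⟩, fun h => hne h.2.symm,
      Or.inl ⟨hcc, rfl, rfl⟩⟩
  · have hv : ∀ {a b : W}, IsAncestor N c' a → ¬ (a = v ∧ b = c) := by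
      rintro a b h ⟨rfl, -⟩
      exact hN.acyclic.not_adj_ancestor hc' h
    obtain ⟨z, hz, hz'⟩ := hl
    obtain ⟨a, b, hca, hab, hbz⟩ := exists_enters hz' hz hcc
    refine ⟨a, b, hab, hv hca, Or.inr ⟨hcc, hca, ?_⟩⟩
    intro y hy hy'
    obtain ⟨a', b', hca', hab', hby⟩ := exists_enters hy' hy hcc
    obtain ⟨-, rfl⟩ := hN.enters_unique hc hab (hv hca) hab' (hv hca')
    exact hby

/-- Edges entering the descendants of one of two linked children of `v` start below `v`. -/
lemma isAncestor_of_enters (hN : IsGalledShape N) {v c c' a b : W} (hc : N.Adj v c)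
    (hc' : N.Adj v c') (hne : c ≠ c') (hl : Linked N c c') (h : Enters N c a b) :
    IsAncestor N v a := by
  by_cases hab : a = v ∧ b = c
  · exact hab.1 ▸ IsAncestor.refl _
  obtain ⟨a', b', h1, h2, h3⟩ := hN.exists_second_enters hc hc' hne hl
  obtain ⟨rfl, rfl⟩ := hN.enters_unique hc h hab h1 h2
  rcases h3 with ⟨-, rfl, -⟩ | ⟨-, h3, -⟩
  · exact IsAncestor.refl _
  · exact (isAncestor_of_adj hc').trans h3

/-- If two linked children of `v` are comparable, the upper one is linked to no third child. -/
lemma not_linked_of_isAncestor (hN : IsGalledShape N) {v c c' c'' : W} (hc : N.Adj v c)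
    (hc' : N.Adj v c') (hc'' : N.Adj v c'') (h₁ : c ≠ c') (h₂ : c ≠ c'') (h₃ : c' ≠ c'')
    (h : IsAncestor N c c') : ¬ Linked N c c'' := by
  intro hl
  obtain ⟨a, b, hab, hne, h4⟩ := hN.exists_second_enters hc hc'' h₂ hl
  have h5 : Enters N c v c' := ⟨hc', hN.acyclic.not_adj_ancestor hc, h⟩
  obtain ⟨rfl, rfl⟩ := hN.enters_unique hc h5 (fun h => h₁ h.2.symm) hab hne
  rcases h4 with ⟨-, -, h4⟩ | ⟨-, h4, -⟩
  · exact h₃ h4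
  · exact hN.acyclic.not_adj_ancestor hc'' h4

/-- A child of `v` is linked to at most one other child of `v`. -/
lemma linked_unique (hN : IsGalledShape N) {v c c' c'' : W} (hc : N.Adj v c)
    (hc' : N.Adj v c') (hc'' : N.Adj v c'') (h₁ : c ≠ c') (h₂ : c ≠ c'') (hl : Linked N c c')
    (hl' : Linked N c c'') : c' = c'' := by
  by_contra h₃
  obtain ⟨a, b, hab, hne, ⟨h, -, -⟩ | ⟨h, hca, hcom⟩⟩ := hN.exists_second_enters hc hc' h₁ hl
  · exact hN.not_linked_of_isAncestor hc hc' hc'' h₁ h₂ h₃ h hl'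
  obtain ⟨a', b', hab', hne', ⟨h', -, -⟩ | ⟨h', hca', hcom'⟩⟩ :=
    hN.exists_second_enters hc hc'' h₂ hl'
  · exact hN.not_linked_of_isAncestor hc hc'' hc' h₂ h₁ (Ne.symm h₃) h' hl
  obtain ⟨rfl, rfl⟩ := hN.enters_unique hc hab hne hab' hne'
  -- the tail `a` of the second edge `(a, b)` entering below `c` is below both `c'` and `c''`
  have hl'' : Linked N c' c'' := ⟨a, hca, hca'⟩
  have hcc : ¬ IsAncestor N c' c := fun h =>
    hN.not_linked_of_isAncestor hc' hc hc'' h₁.symm h₃ h₂ h hl''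
  have hbc : c ≠ b := by
    rintro rfl
    exact hcc (hca.trans (isAncestor_of_adj hab.1))
  obtain ⟨d, hdb, hcd⟩ := hab.2.2.exists_parent hbc
  -- the other parent `d` of `b` is not below `c'`, so `(d, b)` enters below `c'`
  have hdb' : Enters N c' d b := by
    refine ⟨hdb, fun hd => ?_, hca.trans (isAncestor_of_adj hab.1)⟩
    exact hN.acyclic.not_adj_ancestor hdb (hcom d hcd hd)
  have hdv : d ≠ v := by
    rintro rfl
    exact hN.acyclic.not_adj_ancestor hc hcd
  obtain ⟨a', b', h4, h5, h6⟩ := hN.exists_second_enters hc' hc'' h₃ hl''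
  obtain ⟨rfl, rfl⟩ := hN.enters_unique hc' hdb' (fun h => hdv h.1) h4 h5
  rcases h6 with ⟨-, h6, -⟩ | ⟨-, -, h6⟩
  · exact hdv h6
  · exact hN.acyclic.not_adj_ancestor hab.1 (h6 a hca hca')

lemma linked_trans (hN : IsGalledShape N) {v c c' c'' : W} (hc : N.Adj v c)
    (hc' : N.Adj v c') (hc'' : N.Adj v c'') (hl : Linked N c c') (hl' : Linked N c' c'') :
    Linked N c c'' := by
  by_cases h₁ : c' = c
  · exact h₁ ▸ hl'
  by_cases h₂ : c' = c''
  · exact h₂ ▸ hl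
  obtain rfl := hN.linked_unique hc' hc hc'' h₁ h₂ hl.symm hl'
  exact ⟨c, IsAncestor.refl _, IsAncestor.refl _⟩

/-- The common descendants of two linked children of `v` are the descendants of a vertex with two
parents below `v`. -/
lemma exists_hybrid (hN : IsGalledShape N) {v c c' : W} (hc : N.Adj v c)
    (hc' : N.Adj v c') (hne : c ≠ c') (hl : Linked N c c') :
    ∃ w w₁ w₂, w₁ ≠ w₂ ∧ N.Adj w₁ w ∧ N.Adj w₂ w ∧ IsAncestor N v w₁ ∧ IsAncestor N v w₂ ∧
      ∀ z, IsAncestor N w z ↔ IsAncestor N c z ∧ IsAncestor N c' z := by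
  wlog hcc : ¬ IsAncestor N c c' generalizing c c'
  · have hcc' : ¬ IsAncestor N c' c := fun h => hne (hN.acyclic.antisymm (not_not.1 hcc) h)
    obtain ⟨w, w₁, w₂, h1, h2, h3, h4, h5, h6⟩ := this hc' hc hne.symm hl.symm hcc'
    exact ⟨w, w₁, w₂, h1, h2, h3, h4, h5, fun z => (h6 z).trans and_comm⟩
  obtain ⟨a, b, hab, hne', ⟨h, -, -⟩ | ⟨-, hca, hcom⟩⟩ := hN.exists_second_enters hc hc' hne hl
  · exact (hcc h).elim
  have hva : IsAncestor N v a := (isAncestor_of_adj hc').trans hca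
  have hiff : ∀ z, IsAncestor N b z ↔ IsAncestor N c z ∧ IsAncestor N c' z :=
    fun z => ⟨fun h => ⟨hab.2.2.trans h, (hca.trans (isAncestor_of_adj hab.1)).trans h⟩,
      fun h => hcom z h.1 h.2⟩
  obtain ⟨d, hd, hda, h1⟩ := hab.exists_other_parent hc hne'
  refine ⟨b, a, d, hda.symm, hab.1, hd, hva, ?_, hiff⟩
  rcases h1 with h1 | h1
  · exact (isAncestor_of_adj hc).trans h1
  · exact h1.1 ▸ IsAncestor.refl _

end IsGalledShape

end GalledShape

/-! ### The gall responsible for an induced path on four vertices -/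

section Clusters

variable {V W : Type u} {N : Digraph W} {t : branchVertices N → Fin 2} {ℓ : V ≃ leaves N}
  {G : SimpleGraph V}

/-- The leaves below `u`. -/
def cluster (ℓ : V ≃ leaves N) (u : W) : Set V := {x | IsAncestor N u (ℓ x)}

lemma leaf_injective {x y : V} (h : (ℓ x : W) = ℓ y) : x = y :=
  ℓ.injective (Subtype.ext h)

lemma eq_of_isAncestor_leaf [Finite W] {x : V} {u : W} (h : IsAncestor N (ℓ x) u) :
    (ℓ x : W) = u := by
  by_contra hne
  obtain ⟨c, hc, -⟩ := h.exists_child hne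
  exact outdeg_eq_zero_iff.1 (ℓ x).2 c hc

/-- The conclusion drawn from a galled-tree: `A ∪ B ∪ H` is a module that is not `P4`-free, `H` is a
module, `A ∪ H` and `B ∪ H` are `P4`-free, and the adjacency between `A` and `B` is constant,
with value `p`. -/
structure IsGallSplit (G : SimpleGraph V) (A B H : Set V) (p : Prop) : Prop where
  disjointAB : Disjoint A B
  disjointAH : Disjoint A H
  disjointBH : Disjoint B H
  adj_iff : ∀ a ∈ A, ∀ b ∈ B, (G.Adj a b ↔ p)
  isModule : IsModule G H
  isModule_union : IsModule G (A ∪ B ∪ H)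
  freeA : P4FreeOn G (A ∪ H)
  freeB : P4FreeOn G (B ∪ H)
  not_free : ¬ P4FreeOn G (A ∪ B ∪ H)

/-- Adjacency of `x` and `y` depends only on their common ancestors. -/
lemma Explains.adj_of_commonAncestors (hE : Explains N t ℓ G) {x y y' : V} (hxy' : x ≠ y')
    (h : ∀ z, IsAncestor N z (ℓ x) → (IsAncestor N z (ℓ y) ↔ IsAncestor N z (ℓ y')))
    (hadj : G.Adj x y) : G.Adj x y' := by
  obtain ⟨u, ⟨h1, h2, h3⟩, hu⟩ := (hE x y hadj.ne).1 hadj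
  refine (hE x y' hxy').2 ⟨u, ⟨h1, (h _ h1).1 h2, fun c hc hcc => ?_⟩, hu⟩
  exact h3 c hc ⟨hcc.1, (h _ hcc.1).2 hcc.2⟩

lemma Explains.adj_iff_of_isLCA (hE : Explains N t ℓ G) (hN : IsGalledShape N) {x y : V}
    (hxy : x ≠ y) {v : W} (hv : v ∈ branchVertices N) (h : IsLCA N v (ℓ x) (ℓ y)) :
    G.Adj x y ↔ ∃ hv : v ∈ branchVertices N, t ⟨v, hv⟩ = 1 := by
  rw [hE x y hxy]
  constructor
  · rintro ⟨u, hu, hu1⟩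
    obtain rfl := hN.lca_unique hu h
    exact ⟨u.2, hu1⟩
  · rintro ⟨hv, h1⟩
    exact ⟨⟨v, hv⟩, h, h1⟩

/-- In a galled-tree explaining a graph that is not a cograph, take a lowest vertex `v` whose
cluster is not `P4`-free. Any two leaves below unlinked children of `v` are adjacent or not
according to the label of `v`, so a `P4` below `v` lies below two linked children `c` and `c'`. -/
theorem exists_gallSplit [Finite W] (hN : IsGalledShape N) (hE : Explains N t ℓ G)
    (hG : ¬ P4FreeOn G Set.univ) :
    ∃ v c c' w w₁ w₂, N.Adj v c ∧ N.Adj v c' ∧ c ≠ c' ∧ w₁ ≠ w₂ ∧ N.Adj w₁ w ∧ N.Adj w₂ w ∧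
      IsAncestor N v w₁ ∧ IsAncestor N v w₂ ∧
      IsGallSplit G (cluster ℓ c \ cluster ℓ w) (cluster ℓ c' \ cluster ℓ w) (cluster ℓ w)
        (∃ hv : v ∈ branchVertices N, t ⟨v, hv⟩ = 1) := by
  obtain ⟨v, hv, hmin⟩ : ∃ v, ¬ P4FreeOn G (cluster ℓ v) ∧
      ∀ c, N.Adj v c → P4FreeOn G (cluster ℓ c) := by
    obtain ⟨r, hr⟩ := hN.exists_root
    have hne : {v | ¬ P4FreeOn G (cluster ℓ v)}.Nonempty :=
      ⟨r, fun h => hG (h.mono fun x _ => hr _)⟩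
    refine ⟨hN.acyclic.wellFounded_swap.min _ hne, hN.acyclic.wellFounded_swap.min_mem _ hne, ?_⟩
    intro c hc
    by_contra hfree
    exact hN.acyclic.wellFounded_swap.not_lt_min _ hfree hc
  obtain ⟨a, ha, b, hb, c, hc, d, hd, hP⟩ := exists_inducedP4 hv
  -- `v` is not a leaf, so every leaf below `v` is below a child of `v`
  have hchild : ∀ x ∈ cluster ℓ v, ∃ e, N.Adj v e ∧ x ∈ cluster ℓ e := by
    intro x hx
    refine IsAncestor.exists_child hx ?_
    rintro rfl
    exact hP.1.ne ((leaf_injective (eq_of_isAncestor_leaf ha)).symm.trans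
      (leaf_injective (eq_of_isAncestor_leaf hb)))
  have hlca : ∀ {x y : V}, x ∈ cluster ℓ v → y ∈ cluster ℓ v → x ≠ y →
      (∀ e, N.Adj v e → x ∈ cluster ℓ e → y ∉ cluster ℓ e) →
      (G.Adj x y ↔ ∃ hv : v ∈ branchVertices N, t ⟨v, hv⟩ = 1) := by
    intro x y hx hy hxy h
    obtain ⟨e, he, hxe⟩ := hchild x hx
    obtain ⟨e', he', hye⟩ := hchild y hy
    have hne : e ≠ e' := by
      rintro rfl
      exact h e he hxe hye
    exact hE.adj_iff_of_isLCA hN hxy (two_le_outdeg he he' hne)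
      ⟨hx, hy, fun e he hxy => h e he hxy.1 hxy.2⟩
  obtain ⟨c₀, hc₀, hac₀⟩ := hchild a ha
  have hlink : ∀ y, (∃ e e', N.Adj v e ∧ N.Adj v e' ∧ a ∈ cluster ℓ e ∧ y ∈ cluster ℓ e' ∧
      Linked N e e') → ∃ e, N.Adj v e ∧ y ∈ cluster ℓ e ∧ Linked N c₀ e := by
    rintro y ⟨e, e', he, he', hae, hye, hl⟩
    exact ⟨e', he', hye, hN.linked_trans hc₀ he he' ⟨_, hac₀, hae⟩ hl⟩
  obtain ⟨hab, hac, had⟩ := hP.forall_rel ha hb hc hd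
    (r := fun x y => ∃ e e', N.Adj v e ∧ N.Adj v e' ∧ x ∈ cluster ℓ e ∧ y ∈ cluster ℓ e' ∧
      Linked N e e')
    (fun x _ y _ ⟨e, e', h1, h2, h3, h4, h5⟩ => ⟨e', e, h2, h1, h4, h3, h5.symm⟩)
    (fun x _ y _ z _ ⟨e, e', h1, h2, h3, h4, h5⟩ ⟨f, f', k1, k2, k3, k4, k5⟩ =>
      ⟨e, f', h1, k2, h3, k4, hN.linked_trans h1 k1 k2
        (hN.linked_trans h1 h2 k1 h5 ⟨_, h4, k3⟩) k5⟩)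
    (p := ∃ hv : v ∈ branchVertices N, t ⟨v, hv⟩ = 1) (by
      intro x hx y hy hxy
      refine hlca hx hy ?_ fun e he hxe hye => hxy ⟨e, e, he, he, hxe, hye, _, hxe, hxe⟩
      rintro rfl
      obtain ⟨e, he, hxe⟩ := hchild x hx
      exact hxy ⟨e, e, he, he, hxe, hxe, _, hxe, hxe⟩)
  replace hab := hlink b hab
  replace hac := hlink c hac
  replace had := hlink d had
  obtain ⟨c₁, hc₁, hne, hl⟩ : ∃ c₁, N.Adj v c₁ ∧ c₀ ≠ c₁ ∧ Linked N c₀ c₁ := by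
    by_contra hno
    have : ∀ y, (∃ e, N.Adj v e ∧ y ∈ cluster ℓ e ∧ Linked N c₀ e) → y ∈ cluster ℓ c₀ := by
      rintro y ⟨e, he, hye, hl⟩
      by_cases hec : c₀ = e
      · exact hec ▸ hye
      · exact (hno ⟨e, he, hec, hl⟩).elim
    exact hmin c₀ hc₀ a hac₀ b (this b hab) c (this c hac) d (this d had) hP
  have hpair : ∀ e, N.Adj v e → ∀ x, x ∈ cluster ℓ e → x ∈ cluster ℓ c₀ ∪ cluster ℓ c₁ →
      e = c₀ ∨ e = c₁ := by
    intro e he x hxe hx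
    by_contra hcon
    push Not at hcon
    rcases hx with hx | hx
    · exact hcon.2 (hN.linked_unique hc₀ hc₁ he hne hcon.1.symm hl ⟨_, hx, hxe⟩).symm
    · exact hcon.1 (hN.linked_unique hc₁ hc₀ he hne.symm hcon.2.symm hl.symm ⟨_, hx, hxe⟩).symm
  obtain ⟨w, w₁, w₂, hw12, hw₁, hw₂, hvw₁, hvw₂, hw⟩ := hN.exists_hybrid hc₀ hc₁ hne hl
  have hsub₀ : cluster ℓ w ⊆ cluster ℓ c₀ := fun x hx => ((hw _).1 hx).1
  have hsub₁ : cluster ℓ w ⊆ cluster ℓ c₁ := fun x hx => ((hw _).1 hx).2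
  have hinter : ∀ x, x ∈ cluster ℓ c₀ → x ∈ cluster ℓ c₁ → x ∈ cluster ℓ w :=
    fun x h h' => (hw _).2 ⟨h, h'⟩
  have hunion : cluster ℓ c₀ \ cluster ℓ w ∪ cluster ℓ c₁ \ cluster ℓ w ∪ cluster ℓ w
      = cluster ℓ c₀ ∪ cluster ℓ c₁ := by
    ext x
    have := @hsub₀ x
    have := @hsub₁ x
    simp only [Set.mem_union, Set.mem_sdiff]
    tauto
  have hsubv : cluster ℓ c₀ ∪ cluster ℓ c₁ ⊆ cluster ℓ v := by
    rintro x (hx | hx)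
    exacts [(isAncestor_of_adj hc₀).trans hx, (isAncestor_of_adj hc₁).trans hx]
  refine ⟨v, c₀, c₁, w, w₁, w₂, hc₀, hc₁, hne, hw12, hw₁, hw₂, hvw₁, hvw₂, ?_, ?_, ?_, ?_, ?_,
    ?_, ?_, ?_, ?_⟩
  · rw [Set.disjoint_left]
    exact fun x hx hx' => hx.2 (hinter x hx.1 hx'.1)
  · exact Set.disjoint_sdiff_left
  · exact Set.disjoint_sdiff_left
  · rintro x ⟨hx, hxw⟩ y ⟨hy, hyw⟩
    refine hlca (hsubv (Or.inl hx)) (hsubv (Or.inr hy)) ?_ ?_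
    · rintro rfl
      exact hxw (hinter x hx hy)
    · intro e he hxe hye
      rcases hpair e he x hxe (Or.inl hx) with rfl | rfl
      · exact hyw (hinter y hye hy)
      · exact hxw (hinter x hx hxe)
  · intro x hx h hh h' hh'
    refine hE.adj_of_commonAncestors (fun e => hx (e ▸ hh')) fun z hz => ?_
    have hwz : ¬ IsAncestor N w z := fun h => hx (h.trans hz)
    exact ⟨fun h => (hN.isAncestor_of_two_parents hw12 hw₁ hw₂ h hh hwz).trans hh',
      fun h => (hN.isAncestor_of_two_parents hw12 hw₁ hw₂ h hh' hwz).trans hh⟩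
  · rw [hunion]
    intro x hx h hh h' hh'
    by_cases hxv : x ∈ cluster ℓ v
    · have key : ∀ m ∈ cluster ℓ c₀ ∪ cluster ℓ c₁,
          (G.Adj x m ↔ ∃ hv : v ∈ branchVertices N, t ⟨v, hv⟩ = 1) := by
        intro m hm
        refine hlca hxv (hsubv hm) (fun e => hx (e ▸ hm)) fun e he hxe hme => ?_
        rcases hpair e he m hme hm with rfl | rfl
        exacts [hx (Or.inl hxe), hx (Or.inr hxe)]
      exact fun hadj => (key h' hh').2 ((key h hh).1 hadj)
    · -- a common ancestor of `x` and a leaf below `c₀` or `c₁` is above `v`, since edges entering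
      -- the descendants of `c₀` or of `c₁` start below `v`
      have key : ∀ z, IsAncestor N z (ℓ x) → ∀ m ∈ cluster ℓ c₀ ∪ cluster ℓ c₁,
          IsAncestor N z (ℓ m) → IsAncestor N z v := by
        intro z hz m hm hzm
        obtain ⟨s', s, hzs, hs, hsm⟩ := exists_enters hzm (hsubv hm) (fun h => hxv (h.trans hz))
        by_cases hsv : v = s
        · exact hsv ▸ hzs.trans (isAncestor_of_adj hs.1)
        obtain ⟨e, he, hes⟩ := hs.2.2.exists_child hsv
        have hent : Enters N e s' s :=
          ⟨hs.1, fun h => hs.2.1 ((isAncestor_of_adj he).trans h), hes⟩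
        rcases hpair e he m (hes.trans hsm) hm with rfl | rfl
        · exact (hs.2.1 (hN.isAncestor_of_enters hc₀ hc₁ hne hl hent)).elim
        · exact (hs.2.1 (hN.isAncestor_of_enters hc₁ hc₀ hne.symm hl.symm hent)).elim
      refine hE.adj_of_commonAncestors (fun e => hx (e ▸ hh')) fun z hz => ?_
      exact ⟨fun h1 => (key z hz h hh h1).trans (hsubv hh'),
        fun h1 => (key z hz h' hh' h1).trans (hsubv hh)⟩
  · rw [Set.sdiff_union_of_subset hsub₀]
    exact hmin c₀ hc₀
  · rw [Set.sdiff_union_of_subset hsub₁]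
    exact hmin c₁ hc₁
  · rw [hunion]
    have : ∀ y, (∃ e, N.Adj v e ∧ y ∈ cluster ℓ e ∧ Linked N c₀ e) →
        y ∈ cluster ℓ c₀ ∪ cluster ℓ c₁ := by
      rintro y ⟨e, he, hye, hle⟩
      by_cases hec : c₀ = e
      · exact Or.inl (hec ▸ hye)
      · exact Or.inr (hN.linked_unique hc₀ hc₁ he hne hec hl hle ▸ hye)
    exact fun hfree => hfree a (Or.inl hac₀) b (this b hab) c (this c hac) d (this d had) hP

end Clusters

/-! ### Galls in distance-hereditary graphs -/

section GallSplits

variable {V : Type u} {G : SimpleGraph V} {A B H : Set V} {p : Prop}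

/-- In a distance-hereditary graph the ends of an induced `P4` have no common neighbour. -/
lemma IsDistanceHereditary.not_adj_ends (hG : IsDistanceHereditary G) {a b c d e : V}
    (hP : IsInducedP4 G a b c d) (hea : G.Adj e a) : ¬ G.Adj e d := by
  intro hed
  obtain ⟨hab, hbc, hcd, hac, hbd, had⟩ := hP
  let S : Set V := {a, b, c, d}
  have hS : ∀ x ∈ S, x = a ∨ x = b ∨ x = c ∨ x = d := fun x hx => by simpa [S] using hx
  have ha : a ∈ S := by simp [S]
  have hb : b ∈ S := by simp [S]
  have hc : c ∈ S := by simp [S]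
  have hd : d ∈ S := by simp [S]
  have e1 : (G.induce S).Adj ⟨a, ha⟩ ⟨b, hb⟩ := hab
  have e2 : (G.induce S).Adj ⟨b, hb⟩ ⟨c, hc⟩ := hbc
  have e3 : (G.induce S).Adj ⟨c, hc⟩ ⟨d, hd⟩ := hcd
  have hconn : (G.induce S).Connected := by
    rw [SimpleGraph.connected_iff_exists_forall_reachable]
    refine ⟨⟨a, ha⟩, ?_⟩
    rintro ⟨x, hx⟩
    rcases hS x hx with rfl | rfl | rfl | rfl
    · rfl
    · exact e1.reachable
    · exact e1.reachable.trans e2.reachable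
    · exact (e1.reachable.trans e2.reachable).trans e3.reachable
  have hdist := hG S hconn ⟨a, ha⟩ ⟨d, hd⟩
  have h2 : G.dist a d ≤ 2 :=
    SimpleGraph.dist_le (SimpleGraph.Walk.cons hea.symm (SimpleGraph.Walk.cons hed .nil))
  obtain ⟨w, hw⟩ := hconn.exists_walk_length_eq_dist ⟨a, ha⟩ ⟨d, hd⟩
  have hlen : w.length ≤ 2 := by
    rw [hw, ← hdist]
    exact h2
  have hne : a ≠ d := by
    rintro rfl
    exact hac hcd.symm
  cases w with
  | nil => exact hne rfl
  | @cons _ x _ h1 w =>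
    cases w with
    | nil => exact had h1
    | @cons _ y _ h3 w =>
      cases w with
      | nil =>
        have h1' : G.Adj a x := h1
        have h3' : G.Adj x d := h3
        rcases hS x x.2 with hx | hx | hx | hx <;> rw [hx] at h1' h3'
        exacts [had h3', hbd h3', hac h1', had h1']
      | cons h w => simp at hlen

namespace IsGallSplit

lemma symm (h : IsGallSplit G A B H p) : IsGallSplit G B A H p where
  disjointAB := h.disjointAB.symm
  disjointAH := h.disjointBH
  disjointBH := h.disjointAH
  adj_iff a ha b hb := (G.adj_comm a b).trans (h.adj_iff b hb a ha)
  isModule := h.isModule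
  isModule_union := Set.union_comm A B ▸ h.isModule_union
  freeA := h.freeB
  freeB := h.freeA
  not_free := Set.union_comm A B ▸ h.not_free

lemma nonempty_H (h : IsGallSplit G A B H p) : H.Nonempty := by
  rw [Set.nonempty_iff_ne_empty]
  rintro rfl
  refine h.not_free ?_
  have hA := h.freeA
  have hB := h.freeB
  rw [Set.union_empty] at hA hB ⊢
  exact hA.union hB h.adj_iff

lemma nonempty_A (h : IsGallSplit G A B H p) : A.Nonempty := by
  rw [Set.nonempty_iff_ne_empty]
  rintro rfl
  exact h.not_free (by simpa using h.freeB)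

lemma exists_not_adj (h : IsGallSplit G A B H True) {x : V} (hx : x ∈ H) :
    ∃ a ∈ A, ¬ G.Adj a x := by
  by_contra hno
  push Not at hno
  refine h.not_free ?_
  rw [Set.union_assoc]
  refine (h.freeA.mono Set.subset_union_left).union h.freeB (p := True) ?_
  rintro a ha b (hb | hb)
  · exact h.adj_iff a ha b hb
  · simpa using h.isModule a (Set.disjoint_left.1 h.disjointAH ha) x hx b hb (hno a ha)

/-- If `A` is completely joined to `B` and no edge joins `A` to `H`, then the neighbours of `H` in
`B` form a module that separates `H` from `A` and the other vertices of `B`. -/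
lemma exists_of_forall_not_adj (hG : IsDistanceHereditary G) (h : IsGallSplit G A B H True)
    (hA : ∀ a ∈ A, ∀ x ∈ H, ¬ G.Adj a x) : ∃ A' B' H', IsGallSplit G A' B' H' False := by
  obtain ⟨x₀, hx₀⟩ := h.nonempty_H
  obtain ⟨a₀, ha₀⟩ := h.nonempty_A
  have hBH := Set.disjoint_left.1 h.disjointBH
  have hAB := Set.disjoint_left.1 h.disjointAB
  have hAH := Set.disjoint_left.1 h.disjointAH
  have hjoin : ∀ a ∈ A, ∀ b ∈ B, G.Adj a b := fun a ha b hb => (h.adj_iff a ha b hb).2 trivial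
  have hBm : ∀ b ∈ B, ∀ x ∈ H, (G.Adj b x ↔ G.Adj b x₀) := fun b hb x hx =>
    ⟨h.isModule b (hBH hb) x hx x₀ hx₀, h.isModule b (hBH hb) x₀ hx₀ x hx⟩
  have hunion : H ∪ (A ∪ {b ∈ B | ¬ G.Adj b x₀}) ∪ {b ∈ B | G.Adj b x₀} = A ∪ B ∪ H := by
    ext z
    simp only [Set.mem_union, Set.mem_ofPred_eq]
    tauto
  refine ⟨H, A ∪ {b ∈ B | ¬ G.Adj b x₀}, {b ∈ B | G.Adj b x₀}, ?_, ?_, ?_, ?_, ?_, ?_, ?_, ?_, ?_⟩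
  · rw [Set.disjoint_left]
    rintro z hz (hz' | hz')
    exacts [hAH hz' hz, hBH hz'.1 hz]
  · rw [Set.disjoint_left]
    exact fun z hz hz' => hBH hz'.1 hz
  · rw [Set.disjoint_left]
    rintro z (hz | hz) hz'
    exacts [hAB hz hz'.1, hz.2 hz'.2]
  · rintro x hx z (hz | hz)
    · simpa using fun hadj => hA z hz x hx (G.adj_symm hadj)
    · simpa using fun hadj => hz.2 ((hBm z hz.1 x hx).1 (G.adj_symm hadj))
  · rintro x hx b₁ ⟨hb₁, hadj₁⟩ b₂ ⟨hb₂, hadj₂⟩ hxb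
    by_cases hxA : x ∈ A
    · exact hjoin x hxA b₂ hb₂
    by_cases hxH : x ∈ H
    · exact ((hBm b₂ hb₂ x hxH).2 hadj₂).symm
    by_cases hxB : x ∈ B
    · have hxx : ¬ G.Adj x x₀ := fun hadj => hx ⟨hxB, hadj⟩
      by_contra hxb₂
      refine hG.not_adj_ends (a := x₀) (b := b₂) (c := a₀) (d := x) (e := b₁)
        ⟨hadj₂.symm, (hjoin a₀ ha₀ b₂ hb₂).symm, hjoin a₀ ha₀ x hxB,
          fun hadj => hA a₀ ha₀ x₀ hx₀ hadj.symm, fun hadj => hxb₂ hadj.symm,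
          fun hadj => hxx hadj.symm⟩ hadj₁ hxb.symm
    · refine h.isModule_union x ?_ b₁ (Or.inl (Or.inr hb₁)) b₂ (Or.inl (Or.inr hb₂)) hxb
      simp [hxA, hxB, hxH]
  · rw [hunion]
    exact h.isModule_union
  · refine h.freeB.mono ?_
    rintro z (hz | hz)
    exacts [Or.inr hz, Or.inl hz.1]
  · refine ((h.freeA.mono Set.subset_union_left).union (h.freeB.mono Set.subset_union_left)
      h.adj_iff).mono ?_
    rintro z ((hz | hz) | hz)
    exacts [Or.inl hz, Or.inr hz.1, Or.inr hz.1]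
  · rw [hunion]
    exact h.not_free

/-- If `H` has both neighbours and non-neighbours in `A` and in `B`, then distance-heredity joins
the neighbours to the non-neighbours within `A`. -/
lemma adj_of_mixed (hG : IsDistanceHereditary G) (h : IsGallSplit G A B H True) {x a a' b b' : V}
    (ha : a ∈ A) (hax : G.Adj a x) (ha' : a' ∈ A) (ha'x : ¬ G.Adj a' x) (hb : b ∈ B)
    (hbx : G.Adj b x) (hb' : b' ∈ B) (hb'x : ¬ G.Adj b' x) : G.Adj a a' := by
  by_contra hne
  have hjoin : ∀ a ∈ A, ∀ b ∈ B, G.Adj a b := fun a ha b hb => (h.adj_iff a ha b hb).2 trivial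
  exact hG.not_adj_ends (a := x) (b := a) (c := b') (d := a') (e := b)
    ⟨hax.symm, hjoin a ha b' hb', (hjoin a' ha' b' hb').symm, fun hadj => hb'x hadj.symm, hne,
      fun hadj => ha'x hadj.symm⟩ hbx (hjoin a' ha' b hb).symm

/-- In a distance-hereditary graph one can always choose a decomposition in which no edge joins `A`
to `B`. -/
lemma exists_false (hG : IsDistanceHereditary G) (h : IsGallSplit G A B H p) :
    ∃ A' B' H', IsGallSplit G A' B' H' False := by
  by_cases hp : p
  swap
  · simp only [hp] at h
    exact ⟨A, B, H, h⟩
  simp only [hp] at h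
  obtain ⟨x₀, hx₀⟩ := h.nonempty_H
  have hmod : ∀ {A B : Set V}, IsGallSplit G A B H True → ∀ a ∈ A, ∀ x ∈ H,
      (G.Adj a x ↔ G.Adj a x₀) := fun h a ha x hx =>
    ⟨h.isModule a (Set.disjoint_left.1 h.disjointAH ha) x hx x₀ hx₀,
      h.isModule a (Set.disjoint_left.1 h.disjointAH ha) x₀ hx₀ x hx⟩
  obtain ⟨a', ha', ha'x⟩ := h.exists_not_adj hx₀
  obtain ⟨b', hb', hb'x⟩ := h.symm.exists_not_adj hx₀
  by_cases hA : ∃ a ∈ A, G.Adj a x₀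
  swap
  · push Not at hA
    exact h.exists_of_forall_not_adj hG fun a ha x hx hadj => hA a ha ((hmod h a ha x hx).1 hadj)
  by_cases hB : ∃ b ∈ B, G.Adj b x₀
  swap
  · push Not at hB
    exact h.symm.exists_of_forall_not_adj hG
      fun b hb x hx hadj => hB b hb ((hmod h.symm b hb x hx).1 hadj)
  -- now the neighbours of `H` in `A ∪ B` are joined to everything else, so `A ∪ B ∪ H` is a cograph
  obtain ⟨a, ha, hax⟩ := hA
  obtain ⟨b, hb, hbx⟩ := hB
  exfalso
  have hjoin : ∀ a ∈ A, ∀ b ∈ B, G.Adj a b := fun a ha b hb => (h.adj_iff a ha b hb).2 trivial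
  have hA' := h.freeA.mono Set.subset_union_left
  have hB' := h.freeB.mono Set.subset_union_left
  have f1 : P4FreeOn G ({a ∈ A | G.Adj a x₀} ∪ {b ∈ B | G.Adj b x₀}) :=
    (hA'.mono (Set.sep_subset _ _)).union (hB'.mono (Set.sep_subset _ _)) (p := True)
      fun a ha b hb => h.adj_iff a ha.1 b hb.1
  have f2 : P4FreeOn G ({a ∈ A | ¬ G.Adj a x₀} ∪ {b ∈ B | ¬ G.Adj b x₀}) :=
    (hA'.mono (Set.sep_subset _ _)).union (hB'.mono (Set.sep_subset _ _)) (p := True)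
      fun a ha b hb => h.adj_iff a ha.1 b hb.1
  have f3 := (h.freeA.mono Set.subset_union_right).union f2 (p := False) (by
    rintro x hx z (hz | hz)
    · simpa using fun hadj => hz.2 ((hmod h z hz.1 x hx).1 (G.adj_symm hadj))
    · simpa using fun hadj => hz.2 ((hmod h.symm z hz.1 x hx).1 (G.adj_symm hadj)))
  have f4 := f1.union f3 (p := True) (by
    rintro z (hz | hz) y (hy | hy | hy)
    · simpa using (hmod h z hz.1 y hy).2 hz.2
    · simpa using h.adj_of_mixed hG hz.1 hz.2 hy.1 hy.2 hb hbx hb' hb'x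
    · simpa using hjoin z hz.1 y hy.1
    · simpa using (hmod h.symm z hz.1 y hy).2 hz.2
    · simpa using (hjoin y hy.1 z hz.1).symm
    · simpa using h.symm.adj_of_mixed hG hz.1 hz.2 hy.1 hy.2 ha hax ha' ha'x)
  refine h.not_free (f4.mono ?_)
  rintro z ((hz | hz) | hz) <;> by_cases hzx : G.Adj z x₀ <;> simp [hz, hzx]

lemma isModuleSplit (h : IsGallSplit G A B H False)
    (hM : ∀ x ∉ A ∪ B ∪ H, ∀ m ∈ A ∪ B ∪ H, ¬ G.Adj x m) (hfree : P4FreeOn G (A ∪ B ∪ H)ᶜ) :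
    IsModuleSplit G (A ∪ (A ∪ B ∪ H)ᶜ) B H where
  cover x := by
    simp only [Set.mem_union, Set.mem_compl_iff]
    tauto
  disjointAB := by
    rw [Set.disjoint_left]
    rintro x (hx | hx) hxB
    exacts [Set.disjoint_left.1 h.disjointAB hx hxB, hx (Or.inl (Or.inr hxB))]
  disjointAH := by
    rw [Set.disjoint_left]
    rintro x (hx | hx) hxB
    exacts [Set.disjoint_left.1 h.disjointAH hx hxB, hx (Or.inr hxB)]
  disjointBH := h.disjointBH
  not_adj := by
    rintro a (ha | ha) b hb
    exacts [(h.adj_iff a ha b hb).1, hM a ha b (Or.inl (Or.inr hb))]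
  isModule := h.isModule
  freeA := by
    refine (h.freeA.union hfree (p := False) ?_).mono ?_
    · rintro a ha x hx
      have ha' : a ∈ A ∪ B ∪ H := by
        rcases ha with ha | ha
        exacts [Or.inl (Or.inl ha), Or.inr ha]
      simpa using fun hadj => hM x hx a ha' (G.adj_symm hadj)
    · rintro x ((hx | hx) | hx)
      exacts [Or.inl (Or.inl hx), Or.inr hx, Or.inl (Or.inr hx)]
  freeB := h.freeB

end IsGallSplit

/-- In a distance-hereditary graph no vertex is joined to a module containing an induced `P4`. So
the module `A ∪ B ∪ H` is a union of components, and it contains the only one that is not a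
cograph. -/
theorem exists_isModuleSplit [Finite V] (hdh : IsDistanceHereditary G) (hG : IsGaTEx G)
    (hne : ¬ P4FreeOn G Set.univ)
    (huniq : ∃! C : G.ConnectedComponent, ¬ IsCograph C.toSimpleGraph) :
    ∃ A B H, IsModuleSplit G A B H := by
  obtain ⟨W, _, N, t, ℓ, hN, hE⟩ := hG
  obtain ⟨v, c, c', w, w₁, w₂, -, -, -, -, -, -, -, -, hsplit⟩ :=
    exists_gallSplit hN.isGalledShape hE hne
  obtain ⟨A, B, H, h⟩ := hsplit.exists_false hdh
  obtain ⟨a, ha, b, hb, c, hc, d, hd, hP⟩ := exists_inducedP4 h.not_free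
  have hM : ∀ x ∉ A ∪ B ∪ H, ∀ m ∈ A ∪ B ∪ H, ¬ G.Adj x m := fun x hx m hm hadj =>
    hdh.not_adj_ends hP (h.isModule_union x hx m hm a ha hadj)
      (h.isModule_union x hx m hm d hd hadj)
  refine ⟨_, B, H, h.isModuleSplit hM ?_⟩
  by_contra hfree
  obtain ⟨a', ha', b', -, c', -, d', -, hP'⟩ := exists_inducedP4 hfree
  simp only [isCograph_toSimpleGraph_iff] at huniq
  have heq := huniq.unique hP.component_not_p4FreeOn hP'.component_not_p4FreeOn
  obtain ⟨q⟩ := SimpleGraph.ConnectedComponent.exact heq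
  obtain ⟨e, -, he1, he2⟩ := q.exists_boundary_dart (A ∪ B ∪ H) ha ha'
  exact hM _ he2 _ he1 e.adj.symm

end GallSplits

/-! ### Arboreal networks with two roots and galled-trees -/

section AddRoot

variable {W : Type u} {N : Digraph W}

/-- In a tree with two roots at most one edge is left after choosing one parent for every other
vertex: a tree on `n` vertices has `n - 1` edges, and the chosen ones are `n - 2`. -/
lemma extra_parent_unique [Finite W] (hN : IsAcyclicDigraph N)
    (hT : N.toSimpleGraphInclusive.IsTree) (hr : (roots N).ncard = 2) {par : W → W}
    (hpar : ∀ v ∉ roots N, N.Adj (par v) v) {a b a' b' : W} (hab : N.Adj a b) (ha : a ≠ par b)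
    (hab' : N.Adj a' b') (ha' : a' ≠ par b') : a = a' ∧ b = b' := by
  classical
  by_contra hne
  obtain ⟨r, r', hrr, hroots⟩ := Set.ncard_eq_two.1 hr
  let g : W → W × W := fun v => if v = r then (a, b) else if v = r' then (a', b') else (par v, v)
  have gr : g r = (a, b) := by simp [g]
  have gr' : g r' = (a', b') := by simp [g, hrr.symm]
  have gv : ∀ v, v ≠ r → v ≠ r' → g v = (par v, v) := fun v h h' => by simp [g, h, h']
  have hcases : ∀ v, v = r ∨ v = r' ∨ (v ≠ r ∧ v ≠ r') := fun v => by tauto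
  have gadj : ∀ v, N.Adj (g v).1 (g v).2 := by
    intro v
    rcases hcases v with rfl | rfl | ⟨h, h'⟩
    · rwa [gr]
    · rwa [gr']
    · rw [gv v h h']
      exact hpar v (by simp [hroots, h, h'])
  have ginj : Function.Injective g := by
    intro v v' h
    rcases hcases v with rfl | rfl | ⟨h1, h2⟩ <;> rcases hcases v' with rfl | rfl | ⟨h3, h4⟩
    · rfl
    · rw [gr, gr', Prod.mk.injEq] at h
      exact (hne h).elim
    · rw [gr, gv _ h3 h4, Prod.mk.injEq] at h
      exact (ha (h.2 ▸ h.1)).elim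
    · rw [gr, gr', Prod.mk.injEq] at h
      exact (hne ⟨h.1.symm, h.2.symm⟩).elim
    · rfl
    · rw [gr', gv _ h3 h4, Prod.mk.injEq] at h
      exact (ha' (h.2 ▸ h.1)).elim
    · rw [gr, gv _ h1 h2, Prod.mk.injEq] at h
      exact (ha (h.2 ▸ h.1.symm)).elim
    · rw [gr', gv _ h1 h2, Prod.mk.injEq] at h
      exact (ha' (h.2 ▸ h.1.symm)).elim
    · rw [gv _ h1 h2, gv _ h3 h4, Prod.mk.injEq] at h
      exact h.2
  let f : W → N.toSimpleGraphInclusive.edgeSet := fun v =>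
    ⟨s((g v).1, (g v).2), ⟨hN.ne (gadj v), Or.inl (gadj v)⟩⟩
  have finj : Function.Injective f := by
    intro v v' h
    rcases Sym2.eq_iff.1 (congrArg Subtype.val h) with ⟨h1, h2⟩ | ⟨h1, h2⟩
    · exact ginj (Prod.ext h1 h2)
    · have := gadj v'
      rw [← h1, ← h2] at this
      exact (hN.not_adj_ancestor (gadj v) (isAncestor_of_adj this)).elim
  have hcard := (SimpleGraph.isTree_iff_connected_and_card.1 hT).2
  have := Nat.card_le_card_of_injective f finj
  omega

/-- The network `N` with a new root, whose children are the roots of `N`. -/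
def addRoot (N : Digraph W) : Digraph (Option W) where
  Adj
    | none, some v => v ∈ roots N
    | some u, some v => N.Adj u v
    | _, none => False

lemma not_addRoot_adj_none {x : Option W} : ¬ (addRoot N).Adj x none := by
  cases x <;> exact id

lemma addRoot_isAncestor {u : W} {y : Option W} :
    IsAncestor (addRoot N) (some u) y ↔ ∃ v, y = some v ∧ IsAncestor N u v := by
  constructor
  · intro h
    induction h with
    | refl => exact ⟨u, rfl, IsAncestor.refl u⟩
    | @tail b c _ hbc ih =>
      obtain ⟨v, rfl, huv⟩ := ih
      cases c with
      | none => exact hbc.elim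
      | some c => exact ⟨c, rfl, huv.tail hbc⟩
  · rintro ⟨v, rfl, huv⟩
    exact Relation.ReflTransGen.lift some (fun a b hab => hab) _ _ huv

lemma addRoot_isAncestor_some {u v : W} :
    IsAncestor (addRoot N) (some u) (some v) ↔ IsAncestor N u v := by
  rw [addRoot_isAncestor]
  constructor
  · rintro ⟨w, hw, h⟩
    obtain rfl := Option.some.inj hw
    exact h
  · exact fun h => ⟨v, rfl, h⟩

lemma addRoot_acyclic (hN : IsAcyclicDigraph N) : IsAcyclicDigraph (addRoot N) := by
  intro v hv
  obtain ⟨c, hvc, hcv⟩ := Relation.TransGen.tail'_iff.1 hv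
  cases v with
  | none => exact not_addRoot_adj_none hcv
  | some v =>
    obtain ⟨c, rfl, hvc'⟩ := addRoot_isAncestor.1 hvc
    exact hN.not_adj_ancestor hcv hvc'

lemma addRoot_isAncestor_none [Finite W] (hN : IsAcyclicDigraph N) (y : Option W) :
    IsAncestor (addRoot N) none y := by
  cases y with
  | none => exact IsAncestor.refl _
  | some v =>
    obtain ⟨r, hr, hrv⟩ := hN.exists_root_ancestor v
    have h1 : (addRoot N).Adj none (some r) := hr
    exact (isAncestor_of_adj h1).trans (addRoot_isAncestor_some.2 hrv)

lemma addRoot_indeg_none [Finite W] : indeg (addRoot N) none = 0 :=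
  indeg_eq_zero_iff.2 fun _ => not_addRoot_adj_none

lemma addRoot_indeg_of_mem_roots [Finite W] {v : W} (hv : v ∈ roots N) :
    indeg (addRoot N) (some v) = 1 := by
  rw [indeg, Set.ncard_eq_one]
  refine ⟨none, ?_⟩
  ext x
  cases x with
  | none => exact iff_of_true hv rfl
  | some u => exact iff_of_false (indeg_eq_zero_iff.1 hv u) (by simp)

lemma addRoot_indeg_of_not_mem_roots {v : W} (hv : v ∉ roots N) :
    indeg (addRoot N) (some v) = indeg N v := by
  rw [indeg, indeg, ← Set.ncard_image_of_injective _ (Option.some_injective W)]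
  congr 1
  ext x
  cases x with
  | none => exact iff_of_false hv (by simp)
  | some u => exact ⟨fun h => ⟨u, h, rfl⟩, fun ⟨u', h, e⟩ => Option.some.inj e ▸ h⟩

lemma addRoot_outdeg_none : outdeg (addRoot N) none = (roots N).ncard := by
  rw [outdeg, ← Set.ncard_image_of_injective _ (Option.some_injective W)]
  congr 1
  ext x
  cases x with
  | none => exact iff_of_false (not_addRoot_adj_none (N := N) (x := none)) (by simp)
  | some u => exact ⟨fun h => ⟨u, h, rfl⟩, fun ⟨u', h, e⟩ => Option.some.inj e ▸ h⟩

lemma addRoot_outdeg_some {v : W} : outdeg (addRoot N) (some v) = outdeg N v := by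
  rw [outdeg, outdeg, ← Set.ncard_image_of_injective _ (Option.some_injective W)]
  congr 1
  ext x
  cases x with
  | none => exact iff_of_false (not_addRoot_adj_none (N := N) (x := some v)) (by simp)
  | some u => exact ⟨fun h => ⟨u, h, rfl⟩, fun ⟨u', h, e⟩ => Option.some.inj e ▸ h⟩

/-- Adding a root above the two roots of an arboreal network gives a galled-tree: only one vertex
has indegree two. -/
lemma addRoot_isGalledTree [Finite W] (hN : IsArborealNetwork N) (hr : (roots N).ncard = 2) :
    IsGalledTree (addRoot N) := by
  obtain ⟨hnet, hT⟩ := hN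
  have hac : IsAcyclicDigraph N := hnet.acyclic
  have hac' := addRoot_acyclic hac
  obtain ⟨par, hpar⟩ : ∃ par : W → W, ∀ v ∉ roots N, N.Adj (par v) v := by
    have : ∀ v, ∃ p, v ∉ roots N → N.Adj p v := by
      intro v
      by_cases hv : v ∈ roots N
      · exact ⟨v, fun h => (h hv).elim⟩
      · have h1 : ¬ ∀ p, ¬ N.Adj p v := fun h => hv (indeg_eq_zero_iff.2 h)
        push Not at h1
        exact h1.imp fun p hp _ => hp
    choose par hpar using this
    exact ⟨par, hpar⟩
  have hdeg : ∀ v, indeg N v ≤ 2 := by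
    intro v
    by_contra hv
    obtain ⟨p₁, h₁, p₂, h₂, p₃, h₃, h12, h13, h23⟩ :=
      (Set.two_lt_ncard (Set.toFinite _)).1 (not_le.1 hv)
    have key : ∀ {p p' : W}, N.Adj p v → N.Adj p' v → p ≠ p' → p = par v ∨ p' = par v := by
      intro p p' hp hp' hne
      by_contra hcon
      push Not at hcon
      exact hne (extra_parent_unique hac hT hr hpar hp hcon.1 hp' hcon.2).1
    have k1 := key h₁ h₂ h12
    have k2 := key h₁ h₃ h13
    have k3 := key h₂ h₃ h23
    grind
  have huniq : ∀ v v', indeg N v = 2 → indeg N v' = 2 → v = v' := by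
    intro v v' hv hv'
    have key : ∀ {v : W}, indeg N v = 2 → ∃ p, N.Adj p v ∧ p ≠ par v := fun {v} hv =>
      Set.exists_ne_of_one_lt_ncard (s := {p | N.Adj p v}) (by rw [← indeg, hv]; norm_num) (par v)
    obtain ⟨p, hp, hpp⟩ := key hv
    obtain ⟨p', hp', hpp'⟩ := key hv'
    exact (extra_parent_unique hac hT hr hpar hp hpp hp' hpp').2
  refine ⟨⟨⟨?_, hac', ?_, ?_, ?_⟩, none, addRoot_indeg_none, ?_⟩, ?_, ?_⟩
  · rw [SimpleGraph.connected_iff_exists_forall_reachable]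
    refine ⟨none, fun v => ?_⟩
    obtain ⟨w, -, -⟩ := hac'.exists_isPath (addRoot_isAncestor_none hac v)
    exact ⟨w⟩
  · rintro (_ | v) hv
    · rw [addRoot_outdeg_none, hr]
    · rw [addRoot_outdeg_some]
      by_cases hvr : v ∈ roots N
      · exact hnet.two_le_outdeg v hvr
      · rw [addRoot_indeg_of_not_mem_roots hvr] at hv
        exact (hvr hv).elim
  · rintro (_ | v) hv
    · rw [addRoot_outdeg_none, hr] at hv
      omega
    · rw [addRoot_outdeg_some] at hv
      have h1 := hnet.indeg_eq_one v hv
      have hvr : v ∉ roots N := by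
        intro h
        have h0 : indeg N v = 0 := h
        omega
      rw [addRoot_indeg_of_not_mem_roots hvr, h1]
  · rintro (_ | v) ⟨h1, h2⟩
    · rw [addRoot_indeg_none] at h1
      omega
    · rw [addRoot_outdeg_some] at h2
      by_cases hvr : v ∈ roots N
      · have := hnet.two_le_outdeg v hvr
        omega
      · rw [addRoot_indeg_of_not_mem_roots hvr] at h1
        exact hnet.not_subdivision v ⟨h1, h2⟩
  · rintro (_ | v) hv
    · rfl
    · have hv' : indeg (addRoot N) (some v) = 0 := hv
      by_cases hvr : v ∈ roots N
      · rw [addRoot_indeg_of_mem_roots hvr] at hv'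
        omega
      · rw [addRoot_indeg_of_not_mem_roots hvr] at hv'
        exact (hvr hv').elim
  · rintro (_ | v)
    · rw [addRoot_indeg_none]
      omega
    · by_cases hvr : v ∈ roots N
      · rw [addRoot_indeg_of_mem_roots hvr]
        omega
      · rw [addRoot_indeg_of_not_mem_roots hvr]
        exact hdeg v
  · intro C _
    rw [Set.ncard_le_one (Set.toFinite _)]
    have key : ∀ x, indeg (addRoot N) x = 2 → ∃ v, x = some v ∧ indeg N v = 2 := by
      rintro (_ | v) hv
      · rw [addRoot_indeg_none] at hv
        omega
      · refine ⟨v, rfl, ?_⟩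
        by_cases hvr : v ∈ roots N
        · rw [addRoot_indeg_of_mem_roots hvr] at hv
          omega
        · rwa [addRoot_indeg_of_not_mem_roots hvr] at hv
    rintro x ⟨-, hx⟩ y ⟨-, hy⟩
    obtain ⟨v, rfl, hv⟩ := key x hx
    obtain ⟨v', rfl, hv'⟩ := key y hy
    rw [huniq v v' hv hv']

lemma addRoot_isLCA {u x y : W} :
    IsLCA (addRoot N) (some u) (some x) (some y) ↔ IsLCA N u x y := by
  simp only [IsLCA, addRoot_isAncestor_some]
  refine and_congr_right fun _ => and_congr_right fun _ => ⟨fun h c hc hcc => ?_, fun h c hc => ?_⟩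
  · exact h (some c) hc (by simpa [addRoot_isAncestor_some] using hcc)
  · cases c with
    | none => exact (not_addRoot_adj_none hc).elim
    | some c =>
      rw [addRoot_isAncestor_some, addRoot_isAncestor_some]
      exact h c hc

variable {V : Type u} {G : SimpleGraph V}

open Classical in
/-- The labelling of `addRoot N` that extends `t` and labels the new root by `0`. -/
noncomputable def addRootLabel (t : branchVertices N → Fin 2) :
    branchVertices (addRoot N) → Fin 2 :=
  fun u => if ∃ v, ∃ hv : v ∈ branchVertices N, (u : Option W) = some v ∧ t ⟨v, hv⟩ = 1
    then 1 else 0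

lemma addRootLabel_eq_one {t : branchVertices N → Fin 2} {u : branchVertices (addRoot N)} :
    addRootLabel t u = 1 ↔
      ∃ v, ∃ hv : v ∈ branchVertices N, (u : Option W) = some v ∧ t ⟨v, hv⟩ = 1 := by
  unfold addRootLabel
  split_ifs with h
  · exact iff_of_true rfl h
  · exact iff_of_false (by decide) h

/-- The leaves of `addRoot N` are those of `N`. -/
noncomputable def addRootLeaves (ℓ : V ≃ leaves N) (hr : (roots N).ncard = 2) :
    V ≃ leaves (addRoot N) :=
  Equiv.ofBijective
    (fun x => ⟨some (ℓ x), show outdeg (addRoot N) (some (ℓ x : W)) = 0 by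
      rw [addRoot_outdeg_some]; exact (ℓ x).2⟩) (by
    constructor
    · intro x y h
      exact leaf_injective (Option.some.inj (congrArg Subtype.val h))
    · rintro ⟨_ | v, hv⟩
      · have hv' : outdeg (addRoot N) none = 0 := hv
        rw [addRoot_outdeg_none, hr] at hv'
        omega
      · have hv' : outdeg (addRoot N) (some v) = 0 := hv
        rw [addRoot_outdeg_some] at hv'
        exact ⟨ℓ.symm ⟨v, hv'⟩, by simp⟩)

lemma addRootLeaves_apply (ℓ : V ≃ leaves N) (hr : (roots N).ncard = 2) (x : V) :
    (addRootLeaves ℓ hr x : Option W) = some (ℓ x) := rfl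

lemma addRoot_explains {t : branchVertices N → Fin 2} {ℓ : V ≃ leaves N}
    (hr : (roots N).ncard = 2) (hE : Explains N t ℓ G) :
    Explains (addRoot N) (addRootLabel t) (addRootLeaves ℓ hr) G := by
  intro x y hxy
  rw [hE x y hxy]
  simp only [addRootLeaves_apply]
  constructor
  · rintro ⟨⟨u, hu⟩, hlca, ht⟩
    refine ⟨⟨some u, ?_⟩, addRoot_isLCA.2 hlca, addRootLabel_eq_one.2 ⟨u, hu, rfl, ht⟩⟩
    change 2 ≤ outdeg (addRoot N) (some u)
    rw [addRoot_outdeg_some]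
    exact hu
  · rintro ⟨⟨u, hu⟩, hlca, ht⟩
    obtain ⟨v, hv, rfl, ht'⟩ := addRootLabel_eq_one.1 ht
    exact ⟨⟨v, hv⟩, addRoot_isLCA.1 hlca, ht'⟩

theorem ExplainedByArborealNetwork.isGaTEx (h : ExplainedByArborealNetwork 2 G) : IsGaTEx G := by
  obtain ⟨W, _, N, t, ℓ, hN, hr, hE⟩ := h
  exact ⟨Option W, inferInstance, addRoot N, _, _, addRoot_isGalledTree hN hr,
    addRoot_explains hr hE⟩

/-- The decomposition obtained from the galled-tree `addRoot N` belongs to the new root, since below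
every other vertex there is a tree. -/
theorem ExplainedByArborealNetwork.exists_isModuleSplit (h : ExplainedByArborealNetwork 2 G)
    (hG : ¬ P4FreeOn G Set.univ) : ∃ A B H, IsModuleSplit G A B H := by
  obtain ⟨W, _, N, t, ℓ, hN, hr, hE⟩ := h
  have hac : IsAcyclicDigraph N := hN.1.acyclic
  obtain ⟨v, c, c', w, w₁, w₂, hc, hc', hne, hw12, hw₁, hw₂, hvw₁, hvw₂, hsplit⟩ :=
    exists_gallSplit (addRoot_isGalledTree hN hr).isGalledShape (addRoot_explains hr hE) hG
  cases v with
  | some v =>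
    obtain ⟨w₁, rfl, hvw₁'⟩ := addRoot_isAncestor.1 hvw₁
    obtain ⟨w₂, rfl, hvw₂'⟩ := addRoot_isAncestor.1 hvw₂
    cases w with
    | none => exact (not_addRoot_adj_none hw₁).elim
    | some w =>
      exact (hw12 (congrArg some
        (hac.parent_unique hN.2.isAcyclic hw₁ hw₂ hvw₁' hvw₂'))).elim
  | none =>
    cases c with
    | none => exact (not_addRoot_adj_none hc).elim
    | some r =>
    cases c' with
    | none => exact (not_addRoot_adj_none hc').elim
    | some r' =>
    have hp : (∃ hv : none ∈ branchVertices (addRoot N), addRootLabel t ⟨none, hv⟩ = 1) =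
        False := by
      rw [eq_iff_iff, iff_false]
      rintro ⟨hv, h1⟩
      obtain ⟨v, -, h2, -⟩ := addRootLabel_eq_one.1 h1
      cases h2
    rw [hp] at hsplit
    have hrr : r ≠ r' := fun e => hne (congrArg some e)
    have hroots : roots N = {r, r'} := by
      refine (Set.eq_of_subset_of_ncard_le ?_ ?_ (Set.toFinite _)).symm
      · rintro x (rfl | rfl)
        exacts [hc, hc']
      · rw [hr, Set.ncard_pair hrr]
    have hall : ∀ x : V,
        x ∈ cluster (addRootLeaves ℓ hr) (some r) \ cluster (addRootLeaves ℓ hr) w ∪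
        cluster (addRootLeaves ℓ hr) (some r') \ cluster (addRootLeaves ℓ hr) w ∪
        cluster (addRootLeaves ℓ hr) w := by
      intro x
      by_cases hxw : x ∈ cluster (addRootLeaves ℓ hr) w
      · exact Or.inr hxw
      obtain ⟨s, hs, hsx⟩ := hac.exists_root_ancestor (ℓ x : W)
      have hsx' : x ∈ cluster (addRootLeaves ℓ hr) (some s) := addRoot_isAncestor_some.2 hsx
      rw [hroots] at hs
      rcases hs with rfl | rfl
      exacts [Or.inl (Or.inl ⟨hsx', hxw⟩), Or.inl (Or.inr ⟨hsx', hxw⟩)]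
    exact ⟨_, _, _, hsplit.isModuleSplit (fun x hx => (hx (hall x)).elim)
      fun x hx => (hx (hall x)).elim⟩

end AddRoot

/-! ### Families of clusters -/

section Cotrees

variable {V : Type u}

/-- `X` is the disjoint union of two members of `F` that contain all members of `F` properly
contained in `X`, and adjacency between the two parts is constant. In the Hasse diagram of `F` the
set `X` has two children, and it can carry a label. -/
def HasBinarySplit (G : SimpleGraph V) (F : Set (Set (Option V))) (X : Set (Option V)) : Prop :=
  ∃ Y ∈ F, ∃ Z ∈ F, Disjoint Y Z ∧ X = Y ∪ Z ∧ (∀ X' ∈ F, X' ⊂ X → X' ⊆ Y ∨ X' ⊆ Z) ∧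
    ∃ p : Prop, ∀ y z, some y ∈ Y → some z ∈ Z → (G.Adj y z ↔ p)

/-- `X` has a unique maximal proper subset in `F`. -/
def HasOnlyChild (F : Set (Set (Option V))) (X : Set (Option V)) : Prop :=
  ∃ Y ∈ F, Y ⊂ X ∧ ∀ X' ∈ F, X' ⊂ X → X' ⊆ Y

/-- The family of clusters of a binary cotree on `S` in which the vertex `K`, if it occurs, may have
a single child. The point `none` is a spare one: it keeps the cluster `K` of the hybrid vertex
apart from the cluster of its child. -/
structure IsCotreeFamily (G : SimpleGraph V) (K : Set (Option V)) (F : Set (Set (Option V)))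
    (S : Set (Option V)) : Prop where
  top_mem : S ∈ F
  subset : ∀ X ∈ F, X ⊆ S
  nonempty : ∀ X ∈ F, X.Nonempty
  singleton_mem : ∀ v, some v ∈ S → {some v} ∈ F
  split : ∀ X ∈ F, (X = K ∧ HasOnlyChild F X) ∨ (∃ v, X = {some v}) ∨ HasBinarySplit G F X

variable {G : SimpleGraph V} {K S S₁ S₂ : Set (Option V)} {F F₁ F₂ : Set (Set (Option V))}

lemma HasBinarySplit.of_forall {X : Set (Option V)} (h : HasBinarySplit G F₁ X) (hF : F₁ ⊆ F)
    (hX : ∀ X' ∈ F, X' ⊂ X → X' ∈ F₁) : HasBinarySplit G F X :=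
  let ⟨Y, hY, Z, hZ, h1, h2, h3, h4⟩ := h
  ⟨Y, hF hY, Z, hF hZ, h1, h2, fun X' hX' hlt => h3 X' (hX X' hX' hlt) hlt, h4⟩

lemma HasOnlyChild.of_forall {X : Set (Option V)} (h : HasOnlyChild F₁ X) (hF : F₁ ⊆ F)
    (hX : ∀ X' ∈ F, X' ⊂ X → X' ∈ F₁) : HasOnlyChild F X :=
  let ⟨Y, hY, h1, h2⟩ := h
  ⟨Y, hF hY, h1, fun X' hX' hlt => h2 X' (hX X' hX' hlt) hlt⟩

namespace IsCotreeFamily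

lemma union (h₁ : IsCotreeFamily G K F₁ S₁) (h₂ : IsCotreeFamily G K F₂ S₂)
    (hd : Disjoint S₁ S₂) {p : Prop}
    (hp : ∀ y z, some y ∈ S₁ → some z ∈ S₂ → (G.Adj y z ↔ p)) :
    IsCotreeFamily G K (insert (S₁ ∪ S₂) (F₁ ∪ F₂)) (S₁ ∪ S₂) where
  top_mem := Or.inl rfl
  subset := by
    rintro X (rfl | hX | hX)
    exacts [subset_rfl, (h₁.subset X hX).trans Set.subset_union_left,
      (h₂.subset X hX).trans Set.subset_union_right]
  nonempty := by
    rintro X (rfl | hX | hX)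
    exacts [(h₁.nonempty _ h₁.top_mem).inl, h₁.nonempty X hX, h₂.nonempty X hX]
  singleton_mem := by
    rintro v (hv | hv)
    exacts [Or.inr (Or.inl (h₁.singleton_mem v hv)), Or.inr (Or.inr (h₂.singleton_mem v hv))]
  split := by
    have hd' := Set.disjoint_left.1 hd
    rintro X (rfl | hX | hX)
    · refine Or.inr (Or.inr ⟨S₁, Or.inr (Or.inl h₁.top_mem), S₂, Or.inr (Or.inr h₂.top_mem), hd,
        rfl, ?_, p, hp⟩)
      rintro X' (rfl | hX' | hX') hlt
      exacts [(hlt.2 subset_rfl).elim, Or.inl (h₁.subset X' hX'), Or.inr (h₂.subset X' hX')]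
    · have hF : F₁ ⊆ insert (S₁ ∪ S₂) (F₁ ∪ F₂) := fun Y hY => Or.inr (Or.inl hY)
      have hX' : ∀ X' ∈ insert (S₁ ∪ S₂) (F₁ ∪ F₂), X' ⊂ X → X' ∈ F₁ := by
        rintro X' (rfl | hX' | hX') hlt
        · exact (hlt.2 ((h₁.subset X hX).trans Set.subset_union_left)).elim
        · exact hX'
        · obtain ⟨x, hx⟩ := h₂.nonempty X' hX'
          exact (hd' (h₁.subset X hX (hlt.1 hx)) (h₂.subset X' hX' hx)).elim
      exact (h₁.split X hX).imp (And.imp_right (·.of_forall hF hX'))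
        (Or.imp_right (·.of_forall hF hX'))
    · have hF : F₂ ⊆ insert (S₁ ∪ S₂) (F₁ ∪ F₂) := fun Y hY => Or.inr (Or.inr hY)
      have hX' : ∀ X' ∈ insert (S₁ ∪ S₂) (F₁ ∪ F₂), X' ⊂ X → X' ∈ F₂ := by
        rintro X' (rfl | hX' | hX') hlt
        · exact (hlt.2 ((h₂.subset X hX).trans Set.subset_union_right)).elim
        · obtain ⟨x, hx⟩ := h₁.nonempty X' hX'
          exact (hd' (h₁.subset X' hX' hx) (h₂.subset X hX (hlt.1 hx))).elim
        · exact hX'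
      exact (h₂.split X hX).imp (And.imp_right (·.of_forall hF hX'))
        (Or.imp_right (·.of_forall hF hX'))

/-- Two members of the family of clusters of a tree are nested or disjoint. -/
lemma laminar [Finite V] (h : IsCotreeFamily G K F S) {X Y : Set (Option V)} (hX : X ∈ F)
    (hY : Y ∈ F) : X ⊆ Y ∨ Y ⊆ X ∨ Disjoint X Y := by
  have key : ∀ n, ∀ T ∈ F, T.ncard = n → X ⊆ T → Y ⊆ T → X ⊆ Y ∨ Y ⊆ X ∨ Disjoint X Y := by
    intro n
    induction n using Nat.strong_induction_on with
    | _ n ih =>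
      intro T hT hn hXT hYT
      have step : ∀ T' ∈ F, T' ⊂ T → X ⊆ T' → Y ⊆ T' → X ⊆ Y ∨ Y ⊆ X ∨ Disjoint X Y :=
        fun T' hT' hlt => ih _ (hn ▸ Set.ncard_lt_ncard hlt (Set.toFinite _)) T' hT' rfl
      rcases hXT.eq_or_ssubset with rfl | hXT
      · exact Or.inr (Or.inl hYT)
      rcases hYT.eq_or_ssubset with rfl | hYT
      · exact Or.inl hXT.1
      rcases h.split T hT with ⟨-, Z, hZ, hZT, hsub⟩ | ⟨v, rfl⟩ |
        ⟨Z₁, hZ₁, Z₂, hZ₂, hdis, rfl, hsub, -⟩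
      · exact step Z hZ hZT (hsub X hX hXT) (hsub Y hY hYT)
      · rw [Set.ssubset_singleton_iff] at hXT
        exact ((h.nonempty X hX).ne_empty hXT).elim
      · have h1 : Z₁ ⊂ Z₁ ∪ Z₂ := by
          refine ⟨Set.subset_union_left, fun hle => ?_⟩
          obtain ⟨z, hz⟩ := h.nonempty Z₂ hZ₂
          exact Set.disjoint_left.1 hdis (hle (Or.inr hz)) hz
        have h2 : Z₂ ⊂ Z₁ ∪ Z₂ := by
          refine ⟨Set.subset_union_right, fun hle => ?_⟩
          obtain ⟨z, hz⟩ := h.nonempty Z₁ hZ₁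
          exact Set.disjoint_left.1 hdis hz (hle (Or.inl hz))
        rcases hsub X hX hXT with hX1 | hX2 <;> rcases hsub Y hY hYT with hY1 | hY2
        · exact step Z₁ hZ₁ h1 hX1 hY1
        · exact Or.inr (Or.inr (hdis.mono hX1 hY2))
        · exact Or.inr (Or.inr (hdis.symm.mono hX2 hY1))
        · exact step Z₂ hZ₂ h2 hX2 hY2
  exact key _ S h.top_mem rfl (h.subset X hX) (h.subset Y hY)

end IsCotreeFamily

lemma CographOn.exists_isCotreeFamily {A : Set V} (h : CographOn G A) (K : Set (Option V)) :
    ∃ F, IsCotreeFamily G K F (some '' A) := by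
  have hdis : ∀ {A B : Set V}, Disjoint A B → Disjoint (some '' A) (some '' B) := fun h =>
    (Set.disjoint_image_iff (Option.some_injective V)).2 h
  induction h with
  | single v =>
    refine ⟨{{some v}}, by simp, by simp, by simp, ?_, ?_⟩
    · rintro w ⟨w', hw', hw⟩
      obtain rfl := Option.some.inj hw
      obtain rfl := Set.mem_singleton_iff.1 hw'
      rfl
    · rintro X rfl
      exact Or.inr (Or.inl ⟨v, rfl⟩)
  | disjointUnion A B _ _ hAB hadj ihA ihB =>
    obtain ⟨F₁, h₁⟩ := ihA
    obtain ⟨F₂, h₂⟩ := ihB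
    rw [Set.image_union]
    refine ⟨_, h₁.union h₂ (hdis hAB) (p := False) ?_⟩
    simpa using fun y z hy hz => hadj y hy z hz
  | joint A B _ _ hAB hadj ihA ihB =>
    obtain ⟨F₁, h₁⟩ := ihA
    obtain ⟨F₂, h₂⟩ := ihB
    rw [Set.image_union]
    refine ⟨_, h₁.union h₂ (hdis hAB) (p := True) ?_⟩
    simpa using fun y z hy hz => hadj y hy z hz

/-- The cluster of a vertex with a single child whose cluster is `H`. -/
def hybridCluster (H : Set V) : Set (Option V) := insert none (some '' H)

lemma some_mem_hybridCluster {H : Set V} {v : V} : some v ∈ hybridCluster H ↔ v ∈ H := by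
  simp [hybridCluster]

lemma none_mem_hybridCluster {H : Set V} : none ∈ hybridCluster H := Or.inl rfl

lemma IsCotreeFamily.insert_hybridCluster {H : Set V}
    (h : IsCotreeFamily G (hybridCluster H) F (some '' H)) :
    IsCotreeFamily G (hybridCluster H) (insert (hybridCluster H) F) (hybridCluster H) where
  top_mem := Or.inl rfl
  subset := by
    rintro X (rfl | hX)
    exacts [subset_rfl, (h.subset X hX).trans (Set.subset_insert _ _)]
  nonempty := by
    rintro X (rfl | hX)
    exacts [⟨none, none_mem_hybridCluster⟩, h.nonempty X hX]
  singleton_mem v hv := Or.inr (h.singleton_mem v (hv.resolve_left (by simp)))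
  split := by
    have hnone : none ∉ some '' H := by simp
    rintro X (rfl | hX)
    · refine Or.inl ⟨rfl, some '' H, Or.inr h.top_mem, ⟨Set.subset_insert _ _, fun hle =>
        hnone (hle none_mem_hybridCluster)⟩, ?_⟩
      rintro X' (rfl | hX') hlt
      exacts [(hlt.2 subset_rfl).elim, h.subset X' hX']
    · have hF : F ⊆ insert (hybridCluster H) F := Set.subset_insert _ _
      have hX' : ∀ X' ∈ insert (hybridCluster H) F, X' ⊂ X → X' ∈ F := by
        rintro X' (rfl | hX') hlt
        exacts [(hnone (h.subset X hX (hlt.1 none_mem_hybridCluster))).elim, hX']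
      exact (h.split X hX).imp (And.imp_right (·.of_forall hF hX'))
        (Or.imp_right (·.of_forall hF hX'))

/-- A cograph with a proper module `H` splits into two parts, one of which contains `H`: if `H`
meets both parts of a split, then every vertex outside `H` is related to `H` as these two parts
are to each other. -/
lemma P4FreeOn.exists_partition_of_isModule {A H : Set V} (hfin : A.Finite) (hA : P4FreeOn G A)
    (hH : IsModule G H) (hHA : H ⊂ A) (hne : H.Nonempty) :
    ∃ P Q : Set V, ∃ p : Prop, H ⊆ P ∧ Q.Nonempty ∧ Disjoint P Q ∧ P ∪ Q = A ∧
      ∀ x ∈ P, ∀ y ∈ Q, (G.Adj x y ↔ p) := by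
  obtain ⟨x, hx⟩ := hne
  obtain ⟨y, hy, hyH⟩ := Set.exists_of_ssubset hHA
  have hnt : A.Nontrivial := ⟨x, hHA.1 hx, y, hy, fun e => hyH (e ▸ hx)⟩
  obtain ⟨X, Y, hX, hY, hXY, rfl, h⟩ := hA.exists_partition hfin hnt
  obtain ⟨p, hp⟩ : ∃ p : Prop, ∀ x ∈ X, ∀ y ∈ Y, (G.Adj x y ↔ p) := by
    rcases h with h | h
    exacts [⟨False, by simpa using h⟩, ⟨True, by simpa using h⟩]
  by_cases h1 : H ⊆ X
  · exact ⟨X, Y, p, h1, hY, hXY, rfl, hp⟩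
  by_cases h2 : H ⊆ Y
  · exact ⟨Y, X, p, h2, hX, hXY.symm, Set.union_comm _ _, fun y hy x hx =>
      (G.adj_comm y x).trans (hp x hx y hy)⟩
  obtain ⟨y₀, hy₀H, hy₀⟩ := Set.not_subset.1 h1
  obtain ⟨x₀, hx₀H, hx₀⟩ := Set.not_subset.1 h2
  have hy₀Y : y₀ ∈ Y := (hHA.1 hy₀H).resolve_left hy₀
  have hx₀X : x₀ ∈ X := (hHA.1 hx₀H).resolve_right hx₀
  refine ⟨H, (X ∪ Y) \ H, p, subset_rfl, ⟨y, hy, hyH⟩, Set.disjoint_sdiff_right,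
    Set.union_sdiff_cancel hHA.1, ?_⟩
  rintro z hz w ⟨hw | hw, hwH⟩
  · rw [G.adj_comm, ← hp w hw y₀ hy₀Y]
    exact ⟨hH w hwH z hz y₀ hy₀H, hH w hwH y₀ hy₀H z hz⟩
  · rw [G.adj_comm, ← hp x₀ hx₀X w hw, G.adj_comm x₀]
    exact ⟨hH w hwH z hz x₀ hx₀H, hH w hwH x₀ hx₀H z hz⟩

/-- A cograph on `A` with a module `H` has a cotree in which a given cotree of `H` hangs below a
vertex with a single child. -/
lemma P4FreeOn.exists_isCotreeFamily [Finite V] {A H : Set V} {F₀ : Set (Set (Option V))}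
    (hA : P4FreeOn G A) (hH : IsModule G H) (hHA : H ⊆ A) (hne : H.Nonempty)
    (h₀ : IsCotreeFamily G (hybridCluster H) F₀ (hybridCluster H)) :
    ∃ F, IsCotreeFamily G (hybridCluster H) F (hybridCluster A) ∧ F₀ ⊆ F ∧
      ∀ X ∈ F, X ⊆ hybridCluster H → X ∈ F₀ := by
  induction hn : A.ncard using Nat.strong_induction_on generalizing A with
  | _ n ih =>
    rcases hHA.eq_or_ssubset with rfl | hlt
    · exact ⟨F₀, h₀, subset_rfl, fun X hX _ => hX⟩
    obtain ⟨P, Q, p, hHP, hQ, hPQ, rfl, hp⟩ :=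
      hA.exists_partition_of_isModule A.toFinite hH hlt hne
    have hcard : P.ncard < n := by
      have h1 := Set.ncard_union_eq hPQ P.toFinite Q.toFinite
      have h2 := (Set.ncard_pos Q.toFinite).2 hQ
      omega
    obtain ⟨F₁, h₁, hsub, hback⟩ := ih _ hcard (hA.mono Set.subset_union_left) hHP rfl
    obtain ⟨F₂, h₂⟩ := ((hA.mono Set.subset_union_right).cographOn Q.toFinite
      hQ).exists_isCotreeFamily (hybridCluster H)
    have hunion : hybridCluster P ∪ some '' Q = hybridCluster (P ∪ Q) := by
      rw [hybridCluster, hybridCluster, Set.image_union, Set.insert_union]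
    have hdis : Disjoint (hybridCluster P) (some '' Q) := by
      rw [Set.disjoint_left]
      rintro _ hx ⟨y, hy, rfl⟩
      exact Set.disjoint_left.1 hPQ (some_mem_hybridCluster.1 hx) hy
    have h := h₁.union h₂ hdis (p := p) (by
      intro y z hy hz
      exact hp y (some_mem_hybridCluster.1 hy) z (by simpa using hz))
    rw [hunion] at h
    refine ⟨_, h, fun X hX => Or.inr (Or.inl (hsub hX)), ?_⟩
    have hno : ∀ q ∈ Q, some q ∉ hybridCluster H := fun q hq h =>
      Set.disjoint_left.1 hPQ (hHP (some_mem_hybridCluster.1 h)) hq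
    rintro X (rfl | hX | hX) hXH
    · obtain ⟨q, hq⟩ := hQ
      exact (hno q hq (hXH (some_mem_hybridCluster.2 (Or.inr hq)))).elim
    · exact hback X hX hXH
    · obtain ⟨x, hx⟩ := h₂.nonempty X hX
      obtain ⟨q, hq, rfl⟩ := h₂.subset X hX hx
      exact (hno q hq (hXH hx)).elim

/-- The clusters of an arboreal network with two roots and hybrid vertex `K`: two laminar families
with tops `T₁` and `T₂` that share the members contained in `K`. -/
structure IsTwoRootedFamily (G : SimpleGraph V) (F : Set (Set (Option V)))
    (T₁ T₂ K : Set (Option V)) : Prop where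
  mem₁ : T₁ ∈ F
  mem₂ : T₂ ∈ F
  memK : K ∈ F
  inter : T₁ ∩ T₂ = K
  not_le : ¬ T₁ ⊆ T₂
  not_ge : ¬ T₂ ⊆ T₁
  subset : ∀ X ∈ F, X ⊆ T₁ ∨ X ⊆ T₂
  nonempty : ∀ X ∈ F, X.Nonempty
  none_mem : none ∈ K
  singleton_mem : ∀ v, {some v} ∈ F
  laminar₁ : ∀ X ∈ F, ∀ Y ∈ F, X ⊆ T₁ → Y ⊆ T₁ → X ⊆ Y ∨ Y ⊆ X ∨ Disjoint X Y
  laminar₂ : ∀ X ∈ F, ∀ Y ∈ F, X ⊆ T₂ → Y ⊆ T₂ → X ⊆ Y ∨ Y ⊆ X ∨ Disjoint X Y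
  split : ∀ X ∈ F, (X = K ∧ HasOnlyChild F X) ∨ (∃ v, X = {some v}) ∨ HasBinarySplit G F X
  adj : ∀ x y, G.Adj x y → (some x ∈ T₁ ∧ some y ∈ T₁) ∨ (some x ∈ T₂ ∧ some y ∈ T₂)

lemma IsModuleSplit.exists_isTwoRootedFamily [Finite V] {A B H : Set V}
    (h : IsModuleSplit G A B H) (hA : A.Nonempty) (hB : B.Nonempty) (hH : H.Nonempty) :
    ∃ F T₁ T₂ K, IsTwoRootedFamily G F T₁ T₂ K := by
  obtain ⟨F, hF⟩ := ((h.freeA.mono Set.subset_union_right).cographOn H.toFinite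
    hH).exists_isCotreeFamily (hybridCluster H)
  have h₀ := hF.insert_hybridCluster
  obtain ⟨F₁, h₁, hsub₁, hback₁⟩ :=
    h.freeA.exists_isCotreeFamily h.isModule Set.subset_union_right hH h₀
  obtain ⟨F₂, h₂, hsub₂, hback₂⟩ :=
    h.freeB.exists_isCotreeFamily h.isModule Set.subset_union_right hH h₀
  have hAB := Set.disjoint_left.1 h.disjointAB
  have hAH := Set.disjoint_left.1 h.disjointAH
  have hBH := Set.disjoint_left.1 h.disjointBH
  have hinter : hybridCluster (A ∪ H) ∩ hybridCluster (B ∪ H) = hybridCluster H := by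
    ext (_ | x)
    · simp [none_mem_hybridCluster]
    · have := @hAB x
      simp only [Set.mem_inter_iff, some_mem_hybridCluster, Set.mem_union]
      tauto
  have hmem₁ : ∀ X ∈ F₁ ∪ F₂, X ⊆ hybridCluster (A ∪ H) → X ∈ F₁ := by
    rintro X (hX | hX) hle
    · exact hX
    · exact hsub₁ (hback₂ X hX (hinter ▸ Set.subset_inter hle (h₂.subset X hX)))
  have hmem₂ : ∀ X ∈ F₁ ∪ F₂, X ⊆ hybridCluster (B ∪ H) → X ∈ F₂ := by
    rintro X (hX | hX) hle
    · exact hsub₂ (hback₁ X hX (hinter ▸ Set.subset_inter (h₁.subset X hX) hle))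
    · exact hX
  refine ⟨F₁ ∪ F₂, hybridCluster (A ∪ H), hybridCluster (B ∪ H), hybridCluster H,
    Or.inl h₁.top_mem, Or.inr h₂.top_mem, Or.inl (hsub₁ h₀.top_mem), hinter, ?_, ?_, ?_, ?_,
    none_mem_hybridCluster, ?_, ?_, ?_, ?_, ?_⟩
  · obtain ⟨a, ha⟩ := hA
    intro hle
    rcases some_mem_hybridCluster.1 (hle (some_mem_hybridCluster.2 (Or.inl ha))) with h | h
    exacts [hAB ha h, hAH ha h]
  · obtain ⟨b, hb⟩ := hB
    intro hle
    rcases some_mem_hybridCluster.1 (hle (some_mem_hybridCluster.2 (Or.inl hb))) with h | h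
    exacts [hAB h hb, hBH hb h]
  · rintro X (hX | hX)
    exacts [Or.inl (h₁.subset X hX), Or.inr (h₂.subset X hX)]
  · rintro X (hX | hX)
    exacts [h₁.nonempty X hX, h₂.nonempty X hX]
  · intro v
    rcases h.cover v with hv | hv | hv
    · exact Or.inl (h₁.singleton_mem v (some_mem_hybridCluster.2 (Or.inl hv)))
    · exact Or.inr (h₂.singleton_mem v (some_mem_hybridCluster.2 (Or.inl hv)))
    · exact Or.inl (h₁.singleton_mem v (some_mem_hybridCluster.2 (Or.inr hv)))
  · exact fun X hX Y hY hXT hYT => h₁.laminar (hmem₁ X hX hXT) (hmem₁ Y hY hYT)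
  · exact fun X hX Y hY hXT hYT => h₂.laminar (hmem₂ X hX hXT) (hmem₂ Y hY hYT)
  · rintro X (hX | hX)
    · have hX' : ∀ X' ∈ F₁ ∪ F₂, X' ⊂ X → X' ∈ F₁ := fun X' hX' hlt =>
        hmem₁ X' hX' (hlt.1.trans (h₁.subset X hX))
      exact (h₁.split X hX).imp (And.imp_right (·.of_forall Set.subset_union_left hX'))
        (Or.imp_right (·.of_forall Set.subset_union_left hX'))
    · have hX' : ∀ X' ∈ F₁ ∪ F₂, X' ⊂ X → X' ∈ F₂ := fun X' hX' hlt =>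
        hmem₂ X' hX' (hlt.1.trans (h₂.subset X hX))
      exact (h₂.split X hX).imp (And.imp_right (·.of_forall Set.subset_union_right hX'))
        (Or.imp_right (·.of_forall Set.subset_union_right hX'))
  · intro x y hxy
    simp only [some_mem_hybridCluster, Set.mem_union]
    have h1 := h.cover x
    have h2 := h.cover y
    have h3 : ¬ (x ∈ A ∧ y ∈ B) := fun hh => h.not_adj x hh.1 y hh.2 hxy
    have h4 : ¬ (x ∈ B ∧ y ∈ A) := fun hh => h.not_adj y hh.2 x hh.1 hxy.symm
    tauto

end Cotrees

/-! ### Hasse diagrams as networks -/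

section Hasse

/-- A connected acyclic digraph is a tree if `par` gives the only parent of every vertex other than
`r` and `r'`, except that `η` has the further parent `p`. The edges are then the images of the
vertices other than `r'`, when `r` is sent to `(p, η)`. -/
lemma isTree_of_parents {W : Type u} [Finite W] {N : Digraph W}
    (hc : N.toSimpleGraphInclusive.Connected) {r r' p η : W} {par : W → W}
    (h : ∀ a b, N.Adj a b → b ≠ r ∧ b ≠ r' ∧ (a = par b ∨ (a = p ∧ b = η))) (hr : r ≠ r') :
    N.toSimpleGraphInclusive.IsTree := by
  classical
  let g : {v // v ≠ r'} → Sym2 W := fun v => if v.1 = r then s(p, η) else s(par v, v)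
  have key : ∀ a b, N.Adj a b → ∃ v, g v = s(a, b) := by
    intro a b hab
    obtain ⟨h1, h2, rfl | ⟨rfl, rfl⟩⟩ := h a b hab
    · exact ⟨⟨b, h2⟩, by simp [g, h1]⟩
    · exact ⟨⟨r, hr⟩, by simp [g]⟩
  have hg : ∀ e : N.toSimpleGraphInclusive.edgeSet, ∃ v, g v = e := by
    rintro ⟨e, he⟩
    induction e using Sym2.ind with
    | _ a b =>
      have he' : a ≠ b ∧ (N.Adj a b ∨ N.Adj b a) := he
      rcases he'.2 with hab | hab
      · exact key a b hab
      · obtain ⟨v, hv⟩ := key b a hab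
        exact ⟨v, hv.trans Sym2.eq_swap⟩
  choose f hf using hg
  have hinj : Function.Injective f := fun e e' hee =>
    Subtype.ext ((hf e).symm.trans ((congrArg g hee).trans (hf e')))
  have h1 := Nat.card_le_card_of_injective f hinj
  have h2 := hc.card_vert_le_card_edgeSet_add_one
  have h3 : Nat.card {v // v ≠ r'} < Nat.card W := Finite.card_subtype_lt (x := r') (by simp)
  exact SimpleGraph.isTree_iff_connected_and_card.2 ⟨hc, by omega⟩

lemma exists_isLCA {W : Type u} [Finite W] {N : Digraph W} (hN : IsAcyclicDigraph N)
    {u x y : W} (hx : IsAncestor N u x) (hy : IsAncestor N u y) : ∃ v, IsLCA N v x y := by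
  have hne : {v | IsAncestor N v x ∧ IsAncestor N v y}.Nonempty := ⟨u, hx, hy⟩
  obtain ⟨h1, h2⟩ := hN.wellFounded_swap.min_mem _ hne
  exact ⟨_, h1, h2, fun c hc hcc => hN.wellFounded_swap.not_lt_min _ hcc hc⟩

variable (α : Type u) [PartialOrder α]

/-- The Hasse diagram of a partial order, directed downwards. -/
def hasseDown : Digraph α where
  Adj x y := y ⋖ x

variable {α}

lemma hasseDown_isAncestor [Finite α] {x y : α} : IsAncestor (hasseDown α) x y ↔ y ≤ x := by
  classical
  have := Fintype.ofFinite α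
  have : LocallyFiniteOrder α := by
    have : DecidableLE α := Classical.decRel _
    exact Fintype.toLocallyFiniteOrder
  rw [le_iff_reflTransGen_covBy, ← Relation.reflTransGen_swap]
  rfl

lemma hasseDown_acyclic [Finite α] : IsAcyclicDigraph (hasseDown α) := by
  intro v hv
  obtain ⟨c, hvc, hcv⟩ := Relation.TransGen.tail'_iff.1 hv
  exact (CovBy.lt hcv).not_ge (hasseDown_isAncestor.1 hvc)

lemma hasseDown_exists_parent [Finite α] {x y : α} (h : x < y) :
    ∃ p, (hasseDown α).Adj p x ∧ p ≤ y := by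
  obtain ⟨p, hp, hpy⟩ := (hasseDown_isAncestor.2 h.le).exists_parent h.ne'
  exact ⟨p, hp, hasseDown_isAncestor.1 hpy⟩

end Hasse

/-! ### The arboreal network of a family of clusters -/

section Construction

variable {V : Type u} {G : SimpleGraph V} {F : Set (Set (Option V))} {T₁ T₂ K : Set (Option V)}

lemma HasOnlyChild.exists_adj {X : F} (hX : HasOnlyChild F (X : Set (Option V))) :
    ∃ Y : F, (hasseDown F).Adj X Y ∧ ∀ X' : F, X' < X → X' ≤ Y := by
  obtain ⟨Y, hY, hlt, hsub⟩ := hX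
  refine ⟨⟨Y, hY⟩, ?_, fun X' hX' => hsub X' X'.2 hX'⟩
  change (⟨Y, hY⟩ : F) ⋖ X
  exact ⟨hlt, fun c hc hcX => hc.not_ge (hsub c c.2 hcX)⟩

namespace IsTwoRootedFamily

lemma symm (h : IsTwoRootedFamily G F T₁ T₂ K) : IsTwoRootedFamily G F T₂ T₁ K where
  mem₁ := h.mem₂
  mem₂ := h.mem₁
  memK := h.memK
  inter := (Set.inter_comm _ _).trans h.inter
  not_le := h.not_ge
  not_ge := h.not_le
  subset X hX := (h.subset X hX).symm
  nonempty := h.nonempty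
  none_mem := h.none_mem
  singleton_mem := h.singleton_mem
  laminar₁ := h.laminar₂
  laminar₂ := h.laminar₁
  split := h.split
  adj x y hxy := (h.adj x y hxy).symm

lemma K_subset (h : IsTwoRootedFamily G F T₁ T₂ K) : K ⊆ T₁ := h.inter ▸ Set.inter_subset_left

lemma not_subset_K (h : IsTwoRootedFamily G F T₁ T₂ K) : ¬ T₁ ⊆ K := fun hle =>
  h.not_le (hle.trans h.symm.K_subset)

lemma ne_singleton (h : IsTwoRootedFamily G F T₁ T₂ K) {X : Set (Option V)} (hX : K ⊆ X) (v : V) :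
    X ≠ {some v} := by
  rintro rfl
  simpa using hX h.none_mem

/-- Two parents of `X` within one of the two trees agree. -/
lemma parent_eq_of_subset (h : IsTwoRootedFamily G F T₁ T₂ K) {X Y Z : F}
    (hY : (hasseDown F).Adj Y X) (hZ : (hasseDown F).Adj Z X) (hYT : (Y : Set (Option V)) ⊆ T₁)
    (hZT : (Z : Set (Option V)) ⊆ T₁) : Y = Z := by
  obtain ⟨x, hx⟩ := h.nonempty X X.2
  have hY' : X ⋖ Y := hY
  have hZ' : X ⋖ Z := hZ
  rcases h.laminar₁ Y Y.2 Z Z.2 hYT hZT with h1 | h1 | h1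
  · exact ((hZ'.eq_or_eq hY'.le h1).resolve_left hY'.lt.ne')
  · exact ((hY'.eq_or_eq hZ'.le h1).resolve_left hZ'.lt.ne').symm
  · exact (Set.disjoint_left.1 h1 (hY'.le hx) (hZ'.le hx)).elim

/-- Only the hybrid vertex has parents in both trees. -/
lemma parent_eq (h : IsTwoRootedFamily G F T₁ T₂ K) {X Y Z : F} (hX : (X : Set (Option V)) ≠ K)
    (hY : (hasseDown F).Adj Y X) (hZ : (hasseDown F).Adj Z X) : Y = Z := by
  have mixed : ∀ {T₁ T₂ : Set (Option V)}, IsTwoRootedFamily G F T₁ T₂ K → ∀ {Y Z : F},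
      (hasseDown F).Adj Y X → (hasseDown F).Adj Z X → (Y : Set (Option V)) ⊆ T₁ →
      (Z : Set (Option V)) ⊆ T₂ → Y = Z := by
    intro T₁ T₂ h Y Z hY hZ hYT hZT
    have hY' : X ⋖ Y := hY
    have hZ' : X ⋖ Z := hZ
    have hXK : (X : Set (Option V)) ⊆ K :=
      h.inter ▸ Set.subset_inter (subset_trans hY'.le hYT) (subset_trans hZ'.le hZT)
    have hYK : ∀ _ : (Y : Set (Option V)) ⊆ K, Y = Z := fun hYK =>
      h.symm.parent_eq_of_subset hY hZ (hYK.trans h.symm.K_subset) hZT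
    obtain ⟨x, hx⟩ := h.nonempty X X.2
    rcases h.laminar₁ Y Y.2 K h.memK hYT h.K_subset with h1 | h1 | h1
    · exact hYK h1
    · rcases hY'.eq_or_eq (c := ⟨K, h.memK⟩) hXK h1 with h2 | h2
      · exact (hX (congrArg Subtype.val h2).symm).elim
      · exact hYK (h2 ▸ subset_rfl)
    · exact (Set.disjoint_left.1 h1 (hY'.le hx) (hXK hx)).elim
  rcases h.subset Y Y.2 with h1 | h1 <;> rcases h.subset Z Z.2 with h2 | h2
  · exact h.parent_eq_of_subset hY hZ h1 h2
  · exact mixed h hY hZ h1 h2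
  · exact mixed h.symm hY hZ h1 h2
  · exact h.symm.parent_eq_of_subset hY hZ h1 h2

lemma parents_K_ne (h : IsTwoRootedFamily G F T₁ T₂ K) {P Q : F}
    (hP : (hasseDown F).Adj P ⟨K, h.memK⟩) (hPT : (P : Set (Option V)) ⊆ T₁)
    (hQT : (Q : Set (Option V)) ⊆ T₂) : P ≠ Q := by
  rintro rfl
  have hP' : (⟨K, h.memK⟩ : F) ⋖ P := hP
  exact hP'.lt.not_ge (h.inter ▸ Set.subset_inter hPT hQT)

lemma not_adj_top (h : IsTwoRootedFamily G F T₁ T₂ K) (X : F) :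
    ¬ (hasseDown F).Adj X ⟨T₁, h.mem₁⟩ := by
  intro hX
  have hX' : (⟨T₁, h.mem₁⟩ : F) ⋖ X := hX
  rcases h.subset X X.2 with h1 | h1
  · exact hX'.lt.not_ge h1
  · exact h.not_le (subset_trans hX'.le h1)

/-- The two parts of a binary split are children. -/
lemma exists_children (h : IsTwoRootedFamily G F T₁ T₂ K) {X : F}
    (hX : HasBinarySplit G F (X : Set (Option V))) :
    ∃ Y Z : F, Y ≠ Z ∧ (hasseDown F).Adj X Y ∧ (hasseDown F).Adj X Z ∧
      (∀ X' : F, X' < X → X' ≤ Y ∨ X' ≤ Z) ∧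
      ∃ p : Prop, ∀ y z, some y ∈ (Y : Set (Option V)) → some z ∈ (Z : Set (Option V)) →
        (G.Adj y z ↔ p) := by
  obtain ⟨Y, hY, Z, hZ, hdis, hXYZ, hsub, hp⟩ := hX
  have hdis' := Set.disjoint_left.1 hdis
  obtain ⟨y, hy⟩ := h.nonempty Y hY
  obtain ⟨z, hz⟩ := h.nonempty Z hZ
  refine ⟨⟨Y, hY⟩, ⟨Z, hZ⟩, fun e => hdis' hy ((congrArg Subtype.val e).subset hy), ?_, ?_,
    fun X' hlt => hsub X' X'.2 hlt, hp⟩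
  · change (⟨Y, hY⟩ : F) ⋖ X
    refine ⟨⟨hXYZ ▸ Set.subset_union_left, fun hle => hdis' (hle (hXYZ ▸ Or.inr hz)) hz⟩, ?_⟩
    intro c hc hcX
    rcases hsub c c.2 hcX with h1 | h1
    · exact hc.not_ge h1
    · exact hdis' hy (h1 (hc.le hy))
  · change (⟨Z, hZ⟩ : F) ⋖ X
    refine ⟨⟨hXYZ ▸ Set.subset_union_right, fun hle => hdis' hy (hle (hXYZ ▸ Or.inl hy))⟩, ?_⟩
    intro c hc hcX
    rcases hsub c c.2 hcX with h1 | h1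
    · exact hdis' (h1 (hc.le hz)) hz
    · exact hc.not_ge h1

variable [Finite V]

lemma exists_parent_K (h : IsTwoRootedFamily G F T₁ T₂ K) :
    ∃ P : F, (hasseDown F).Adj P ⟨K, h.memK⟩ ∧ (P : Set (Option V)) ⊆ T₁ := by
  have hlt : (⟨K, h.memK⟩ : F) < ⟨T₁, h.mem₁⟩ := ⟨h.K_subset, h.not_subset_K⟩
  obtain ⟨P, hP, hPT⟩ := hasseDown_exists_parent hlt
  exact ⟨P, hP, hPT⟩

lemma exists_parent (h : IsTwoRootedFamily G F T₁ T₂ K) {X : F} (h₁ : (X : Set (Option V)) ≠ T₁)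
    (h₂ : (X : Set (Option V)) ≠ T₂) : ∃ P : F, (hasseDown F).Adj P X := by
  rcases h.subset X X.2 with hX | hX
  · have hlt : X < ⟨T₁, h.mem₁⟩ := lt_of_le_of_ne hX fun e => h₁ (congrArg Subtype.val e)
    exact (hasseDown_exists_parent hlt).imp fun _ => And.left
  · have hlt : X < ⟨T₂, h.mem₂⟩ := lt_of_le_of_ne hX fun e => h₂ (congrArg Subtype.val e)
    exact (hasseDown_exists_parent hlt).imp fun _ => And.left

lemma indeg_eq_zero (h : IsTwoRootedFamily G F T₁ T₂ K) {X : F} :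
    indeg (hasseDown F) X = 0 ↔ (X : Set (Option V)) = T₁ ∨ (X : Set (Option V)) = T₂ := by
  rw [indeg_eq_zero_iff]
  constructor
  · intro hX
    by_contra hne
    push Not at hne
    obtain ⟨P, hP⟩ := h.exists_parent hne.1 hne.2
    exact hX P hP
  · obtain ⟨X, hX⟩ := X
    rintro (rfl | rfl)
    exacts [h.not_adj_top, h.symm.not_adj_top]

lemma outdeg_singleton (h : IsTwoRootedFamily G F T₁ T₂ K) (v : V) :
    outdeg (hasseDown F) ⟨{some v}, h.singleton_mem v⟩ = 0 := by
  rw [outdeg_eq_zero_iff]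
  intro Y hY
  have hY' : Y ⋖ ⟨{some v}, h.singleton_mem v⟩ := hY
  have hlt : (Y : Set (Option V)) ⊂ {some v} := hY'.lt
  rw [Set.ssubset_singleton_iff] at hlt
  exact (h.nonempty Y Y.2).ne_empty hlt

lemma two_le_outdeg (h : IsTwoRootedFamily G F T₁ T₂ K) {X : F}
    (hX : HasBinarySplit G F (X : Set (Option V))) : 2 ≤ outdeg (hasseDown F) X := by
  obtain ⟨Y, Z, hne, hY, hZ, -⟩ := h.exists_children hX
  exact ArborealNetworks.two_le_outdeg hY hZ hne

lemma two_le_indeg_K (h : IsTwoRootedFamily G F T₁ T₂ K) :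
    2 ≤ indeg (hasseDown F) ⟨K, h.memK⟩ := by
  obtain ⟨P, hP, hPT⟩ := h.exists_parent_K
  obtain ⟨Q, hQ, hQT⟩ := h.symm.exists_parent_K
  exact two_le_indeg hP hQ (h.parents_K_ne hP hPT hQT)

lemma two_le_outdeg_top (h : IsTwoRootedFamily G F T₁ T₂ K) :
    2 ≤ outdeg (hasseDown F) ⟨T₁, h.mem₁⟩ := by
  rcases h.split T₁ h.mem₁ with ⟨h1, -⟩ | ⟨v, h1⟩ | h1
  · exact (h.not_subset_K h1.subset).elim
  · exact (h.ne_singleton h.K_subset v h1).elim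
  · exact h.two_le_outdeg (X := ⟨T₁, h.mem₁⟩) h1

lemma eq_singleton_of_outdeg (h : IsTwoRootedFamily G F T₁ T₂ K) {X : F}
    (hX : outdeg (hasseDown F) X = 0) : ∃ v, (X : Set (Option V)) = {some v} := by
  rcases h.split X X.2 with ⟨-, h1⟩ | h1 | h1
  · obtain ⟨Y, hY, -⟩ := h1.exists_adj
    exact (outdeg_eq_zero_iff.1 hX Y hY).elim
  · exact h1
  · have := h.two_le_outdeg h1
    omega

lemma connected (h : IsTwoRootedFamily G F T₁ T₂ K) :
    (hasseDown F).toSimpleGraphInclusive.Connected := by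
  have hreach : ∀ {X Y : F}, X ≤ Y → (hasseDown F).toSimpleGraphInclusive.Reachable X Y := by
    intro X Y hXY
    obtain ⟨w, -, -⟩ := hasseDown_acyclic.exists_isPath (hasseDown_isAncestor.2 hXY)
    exact ⟨w.reverse⟩
  have h1 : (⟨K, h.memK⟩ : F) ≤ ⟨T₁, h.mem₁⟩ := h.K_subset
  have h2 : (⟨K, h.memK⟩ : F) ≤ ⟨T₂, h.mem₂⟩ := h.symm.K_subset
  rw [SimpleGraph.connected_iff_exists_forall_reachable]
  refine ⟨⟨K, h.memK⟩, fun X => ?_⟩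
  rcases h.subset X X.2 with hX | hX
  · have h3 : X ≤ ⟨T₁, h.mem₁⟩ := hX
    exact (hreach h1).trans (hreach h3).symm
  · have h3 : X ≤ ⟨T₂, h.mem₂⟩ := hX
    exact (hreach h2).trans (hreach h3).symm

lemma isNetwork (h : IsTwoRootedFamily G F T₁ T₂ K) : IsNetwork (hasseDown F) where
  connected := h.connected
  acyclic := hasseDown_acyclic
  two_le_outdeg X hX := by
    obtain ⟨X, hXF⟩ := X
    rcases h.indeg_eq_zero.1 hX with h1 | h1
    · obtain rfl : X = T₁ := h1
      exact h.two_le_outdeg_top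
    · obtain rfl : X = T₂ := h1
      exact h.symm.two_le_outdeg_top
  indeg_eq_one X hX := by
    obtain ⟨v, hv⟩ := h.eq_singleton_of_outdeg hX
    have h1 : (X : Set (Option V)) ≠ T₁ := fun e => h.ne_singleton h.K_subset v (e ▸ hv)
    have h2 : (X : Set (Option V)) ≠ T₂ := fun e => h.ne_singleton h.symm.K_subset v (e ▸ hv)
    have h3 : (X : Set (Option V)) ≠ K := fun e => h.ne_singleton subset_rfl v (e ▸ hv)
    obtain ⟨P, hP⟩ := h.exists_parent h1 h2
    rw [indeg, Set.ncard_eq_one]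
    exact ⟨P, Set.eq_singleton_iff_unique_mem.2 ⟨hP, fun Q hQ => h.parent_eq h3 hQ hP⟩⟩
  not_subdivision X hX := by
    obtain ⟨X, hXF⟩ := X
    rcases h.split X hXF with ⟨rfl, -⟩ | ⟨v, rfl⟩ | h1
    · have := h.two_le_indeg_K
      omega
    · have := h.outdeg_singleton v
      omega
    · have := h.two_le_outdeg (X := ⟨X, hXF⟩) h1
      omega

lemma isTree (h : IsTwoRootedFamily G F T₁ T₂ K) :
    (hasseDown F).toSimpleGraphInclusive.IsTree := by
  obtain ⟨P, hP, hPT⟩ := h.exists_parent_K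
  obtain ⟨Q, hQ, hQT⟩ := h.symm.exists_parent_K
  obtain ⟨par, hparK, hpar⟩ : ∃ par : F → F, par ⟨K, h.memK⟩ = P ∧
      ∀ X Y : F, (X : Set (Option V)) ≠ K → (hasseDown F).Adj Y X → Y = par X := by
    classical
    have : ∀ X : F, ∃ Z, (X : Set (Option V)) ≠ K → ∀ Y, (hasseDown F).Adj Y X → Y = Z := by
      intro X
      by_cases hX : ∃ Z, (hasseDown F).Adj Z X
      · exact hX.imp fun Z hZ hXK Y hY => h.parent_eq hXK hY hZ
      · exact ⟨X, fun _ Y hY => (hX ⟨Y, hY⟩).elim⟩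
    choose par hpar using this
    refine ⟨Function.update par ⟨K, h.memK⟩ P, by simp, fun X Y hXK hY => ?_⟩
    rw [Function.update_of_ne fun e => hXK (congrArg Subtype.val e)]
    exact hpar X hXK Y hY
  refine isTree_of_parents h.connected (r := ⟨T₁, h.mem₁⟩) (r' := ⟨T₂, h.mem₂⟩) (p := Q)
    (η := ⟨K, h.memK⟩) (par := par) ?_ fun e => h.not_le (congrArg Subtype.val e : T₁ = T₂).subset
  intro Y X hYX
  refine ⟨?_, ?_, ?_⟩
  · rintro rfl
    exact h.not_adj_top Y hYX
  · rintro rfl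
    exact h.symm.not_adj_top Y hYX
  · by_cases hXK : X = ⟨K, h.memK⟩
    · subst hXK
      rcases h.subset Y Y.2 with hY | hY
      · exact Or.inl ((h.parent_eq_of_subset hYX hP hY hPT).trans hparK.symm)
      · exact Or.inr ⟨h.symm.parent_eq_of_subset hYX hQ hY hQT, rfl⟩
    · exact Or.inl (hpar X Y (fun e => hXK (Subtype.ext e)) hYX)

lemma ncard_roots (h : IsTwoRootedFamily G F T₁ T₂ K) : (roots (hasseDown F)).ncard = 2 := by
  have hroots : roots (hasseDown F) = {⟨T₁, h.mem₁⟩, ⟨T₂, h.mem₂⟩} := by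
    ext X
    rw [Set.mem_insert_iff, Set.mem_singleton_iff, Subtype.ext_iff, Subtype.ext_iff]
    exact h.indeg_eq_zero
  rw [hroots, Set.ncard_pair fun e => h.not_le (congrArg Subtype.val e : T₁ = T₂).subset]

/-- The leaves are the singletons `{some v}`. -/
noncomputable def leafEquiv (h : IsTwoRootedFamily G F T₁ T₂ K) : V ≃ leaves (hasseDown F) :=
  Equiv.ofBijective (fun v => ⟨⟨{some v}, h.singleton_mem v⟩, h.outdeg_singleton v⟩) (by
    constructor
    · intro v w hvw
      have : ({some v} : Set (Option V)) = {some w} :=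
        congrArg (fun X : leaves (hasseDown F) => ((X : F) : Set (Option V))) hvw
      exact Option.some.inj (Set.singleton_injective this)
    · rintro ⟨⟨X, hXF⟩, hX⟩
      obtain ⟨v, hv⟩ := h.eq_singleton_of_outdeg hX
      obtain rfl : X = {some v} := hv
      exact ⟨v, rfl⟩)

lemma isAncestor_leaf (h : IsTwoRootedFamily G F T₁ T₂ K) {X : F} {v : V} :
    IsAncestor (hasseDown F) X (h.leafEquiv v : F) ↔ some v ∈ (X : Set (Option V)) := by
  rw [hasseDown_isAncestor]
  exact Set.singleton_subset_iff

/-- Adjacency is constant on the pairs of leaves with a given least common ancestor. -/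
lemma isLCA_adj (h : IsTwoRootedFamily G F T₁ T₂ K) (X : F) :
    ∃ p : Prop, ∀ x y : V, x ≠ y → IsLCA (hasseDown F) X (h.leafEquiv x : F) (h.leafEquiv y : F) →
      X ∈ branchVertices (hasseDown F) ∧ (G.Adj x y ↔ p) := by
  have below : ∀ {x y : V}, x ≠ y → some x ∈ (X : Set (Option V)) →
      some y ∈ (X : Set (Option V)) → (⟨{some x}, h.singleton_mem x⟩ : F) < X := by
    intro x y hxy hx hy
    refine ⟨Set.singleton_subset_iff.2 hx, fun hle => hxy ?_⟩
    exact (Option.some.inj (Set.mem_singleton_iff.1 (hle hy))).symm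
  simp only [IsLCA, isAncestor_leaf]
  rcases h.split X X.2 with ⟨-, h1⟩ | ⟨v, h1⟩ | h1
  · obtain ⟨Y, hY, hsub⟩ := h1.exists_adj
    refine ⟨True, fun x y hxy ⟨hx, hy, hno⟩ => (hno Y hY ⟨?_, ?_⟩).elim⟩
    · exact hsub _ (below hxy hx hy) rfl
    · exact hsub _ (below hxy.symm hy hx) rfl
  · refine ⟨True, fun x y hxy ⟨hx, hy, _⟩ => (hxy ?_).elim⟩
    rw [h1, Set.mem_singleton_iff] at hx hy
    exact Option.some.inj (hx.trans hy.symm)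
  · obtain ⟨Y, Z, -, hY, hZ, hsub, p, hp⟩ := h.exists_children h1
    refine ⟨p, fun x y hxy ⟨hx, hy, hno⟩ => ⟨h.two_le_outdeg h1, ?_⟩⟩
    have hx' : some x ∈ (Y : Set (Option V)) ∨ some x ∈ (Z : Set (Option V)) :=
      (hsub _ (below hxy hx hy)).imp (fun hle => hle rfl) (fun hle => hle rfl)
    have hy' : some y ∈ (Y : Set (Option V)) ∨ some y ∈ (Z : Set (Option V)) :=
      (hsub _ (below hxy.symm hy hx)).imp (fun hle => hle rfl) (fun hle => hle rfl)
    rcases hx' with hx' | hx' <;> rcases hy' with hy' | hy'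
    · exact (hno Y hY ⟨hx', hy'⟩).elim
    · exact hp x y hx' hy'
    · rw [G.adj_comm]
      exact hp y x hy' hx'
    · exact (hno Z hZ ⟨hx', hy'⟩).elim

theorem explainedByArborealNetwork (h : IsTwoRootedFamily G F T₁ T₂ K) :
    ExplainedByArborealNetwork 2 G := by
  classical
  choose p hp using h.isLCA_adj
  refine ⟨F, inferInstance, hasseDown F, fun X => if p X then 1 else 0, h.leafEquiv,
    ⟨h.isNetwork, h.isTree⟩, h.ncard_roots, ?_⟩
  intro x y hxy
  constructor
  · intro hadj
    obtain ⟨u, hu⟩ : ∃ u, IsLCA (hasseDown F) u (h.leafEquiv x : F) (h.leafEquiv y : F) := by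
      rcases h.adj x y hadj with ⟨hx, hy⟩ | ⟨hx, hy⟩
      · exact exists_isLCA hasseDown_acyclic (u := (⟨T₁, h.mem₁⟩ : F)) (h.isAncestor_leaf.2 hx)
          (h.isAncestor_leaf.2 hy)
      · exact exists_isLCA hasseDown_acyclic (u := (⟨T₂, h.mem₂⟩ : F)) (h.isAncestor_leaf.2 hx)
          (h.isAncestor_leaf.2 hy)
    obtain ⟨hbr, hiff⟩ := hp u x y hxy hu
    exact ⟨⟨u, hbr⟩, hu, if_pos (hiff.1 hadj)⟩
  · rintro ⟨⟨u, hbr⟩, hu, ht⟩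
    refine (hp u x y hxy hu).2.2 ?_
    by_contra hpu
    simp [hpu] at ht

end IsTwoRootedFamily

end Construction

end ArborealNetworks

theorem mainTheorem6 {V : Type u} [Finite V] [Nonempty V] (G : SimpleGraph V)
    (hG : ¬ ArborealNetworks.IsCograph G) :
    ArborealNetworks.ExplainedByArborealNetwork 2 G ↔
      (ArborealNetworks.IsDistanceHereditary G ∧ ArborealNetworks.IsGaTEx G ∧
        ∃! C : G.ConnectedComponent, ¬ ArborealNetworks.IsCograph C.toSimpleGraph) := by
  have hfree : ¬ ArborealNetworks.P4FreeOn G Set.univ :=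
    fun h => hG ((ArborealNetworks.isCograph_iff G).2 h)
  constructor
  · intro h
    obtain ⟨A, B, H, hsplit⟩ := h.exists_isModuleSplit hfree
    exact ⟨hsplit.isDistanceHereditary, h.isGaTEx, hsplit.existsUnique_component hG⟩
  · rintro ⟨hdh, hgt, huniq⟩
    obtain ⟨A, B, H, h⟩ := ArborealNetworks.exists_isModuleSplit hdh hgt hfree huniq
    obtain ⟨F, T₁, T₂, K, hF⟩ := h.exists_isTwoRootedFamily
      (h.inter_A_nonempty hfree).right (h.symm.inter_A_nonempty hfree).right
      (h.inter_H_nonempty hfree).right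
    exact hF.explainedByArborealNetwork
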